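/- Consider dependent type theory with commuting focuses: homotopy type theory in which every variable of a context carries a focus, $x :_\varphi A$, where the focuses form a meet-semilattice with top element $\top$ (meet written $\varphi\psi$; ordinary variables have focus $\top$). For a context $\Gamma$, let $\varphi\Gamma$ be $\Gamma$ with every annotation $\chi$ replaced by $\varphi\chi$, and let $\varphi\setminus\Gamma$ be $\Gamma$ with all variables of focus $\not\le\varphi$ deleted; a declaration $x:_\varphi A$ may be added to $\Gamma$ if $\varphi\setminus\Gamma\vdash A\ \mathsf{type}$. A type or term is $\varphi$-crisp if it is well-formed in $\varphi\setminus\Gamma$. Besides the usual type formers there are, for every focus $\varphi$: a comodality $\flat_\varphi$, where $\varphi\setminus\Gamma\vdash M:A$ gives $\Gamma\vdash M^{\flat_\varphi}:\flat_\varphi A$, with the crisp induction principle that for $\psi\setminus\Gamma\vdash M:\flat_\varphi A$ and $\Gamma,u:_{\psi\varphi}A\vdash N:C[u^{\flat_\varphi}/x]$ (where $\Gamma,x:_\psi\flat_\varphi A\vdash C\ \mathsf{type}$) there is $(\mathsf{let}\ u^{\flat_\varphi}:=M\ \mathsf{in}\ N):C[M/x]$ with the definitional $\beta$-rule; and a modality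 $\sharp_\varphi$, where $\varphi\Gamma\vdash M:A$ gives $\Gamma\vdash M^{\sharp_\varphi}:\sharp_\varphi A$, and $\varphi\setminus\Gamma\vdash N:\sharp_\varphi A$ gives $\Gamma\vdash N_{\sharp_\varphi}:A$, with definitional $\beta$- and $\eta$-rules. Let $\varphi,\psi$ be focuses and $\Gamma$ a context of this theory, possibly extended by postulated closed constants and closed definitional equations. Then the following holds in $\Gamma$. (1) For every $\varphi\psi$-crisp type $A$, the map $\flat_\varphi\flat_\psi A\to\flat_\psi\flat_\varphi A$, $$u\mapsto \mathsf{let}\ v^{\flat_\varphi}:=u\ \mathsf{in}\ \bigl(\mathsf{let}\ w^{\flat_\psi}:=v\ \mathsf{in}\ (w^{\flat_\varphi})^{\flat_\psi}\bigr),$$ is well-typed and is an equivalence (the type of proofs that it has a left and a right inverse is inhabited). It is natural in $A$: for every $\varphi\psi$-crisp type $B$ and every $\varphi\psi$-crisp function $f:A\to B$, the maps $\flat_\varphi\flat_\psi f$ and $\flat_\psi\flat_\varphi f$ are well-typed and there is a term of type $$\prod_{u:\flat_\varphi\flat_\psi A}\ \flat_\psi\flat_\varphi f\,(c_A(u)) =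 c_B\,(\flat_\varphi\flat_\psi f(u)),$$ where $c_A$, $c_B$ are the maps above for $A$ and $B$, and $\flat_\varphi g$ is $u\mapsto\mathsf{let}\ v^{\flat_\varphi}:=u\ \mathsf{in}\ (g(v))^{\flat_\varphi}$. (2) For every type $B$ (well-formed in $\varphi\psi\Gamma$), the maps $$\sharp_\varphi\sharp_\psi B\to\sharp_\psi\sharp_\varphi B,\quad x\mapsto (x_{\sharp_\varphi})_{\sharp_\psi}{}^{\sharp_\varphi}{}^{\sharp_\psi},\qquad \sharp_\varphi\sharp_\psi B\to\sharp_{\varphi\psi}B,\quad x\mapsto (x_{\sharp_\varphi})_{\sharp_\psi}{}^{\sharp_{\varphi\psi}},\qquad \sharp_\psi\sharp_\varphi B\to\sharp_{\varphi\psi}B,\quad x\mapsto (x_{\sharp_\psi})_{\sharp_\varphi}{}^{\sharp_{\varphi\psi}}$$ are well-typed equivalences, and they have definitional inverses: respectively the first map with $\varphi$ and $\psi$ exchanged, $x\mapsto x_{\sharp_{\varphi\psi}}{}^{\sharp_\psi}{}^{\sharp_\varphi}$, and $x\mapsto x_{\sharp_{\varphi\psi}}{}^{\sharp_\varphi}{}^{\sharp_\psi}$;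 both composites are definitionally equal to the identity functions. -/

import Mathlib

universe u v

/-!
Dependent type theory with commuting focuses, as a formal system.

The focuses form a meet-semilattice `F` with a top element (a commutative idempotent monoid, with
`⊓` as product and `φ ≤ ψ ↔ φ ⊓ ψ = φ`).  Raw terms are in locally nameless style: bound variables
are de Bruijn indices, free variables are names (natural numbers), so that a context really is a
list of declarations `x :_φ A` and deleting declarations from a context does not change the terms.
The rules for the standard type formers are those of the formal presentation of homotopy type
theory in the HoTT book: types are the elements of a cumulative hierarchy of universes
(à la Russell), and `A type` means `A : U_i` for some `i`.
-/

/-- Raw terms and types over the focuses `F` and the constants `K`.  The numbers of variables bound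
in the arguments are listed on the right (`0` where nothing is said).  If several variables are
bound, the last one has index `0`. -/
inductive Tm (F : Type u) (K : Type v) : Type (max u v)
  | bvar : ℕ → Tm F K
  | fvar : ℕ → Tm F K
  | con : K → Tm F K
  | univ : ℕ → Tm F K
  -- `pi A B`, `lam A b`: `B` and `b` bind one variable
  | pi : Tm F K → Tm F K → Tm F K
  | lam : Tm F K → Tm F K → Tm F K
  | app : Tm F K → Tm F K → Tm F K
  -- `sigma A B`: `B` binds one;  `sigmaInd C g p`: `C` binds one, `g` binds two
  | sigma : Tm F K → Tm F K → Tm F K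
  | pair : Tm F K → Tm F K → Tm F K
  | sigmaInd : Tm F K → Tm F K → Tm F K → Tm F K
  -- `sumInd C l r p`: `C`, `l`, `r` bind one
  | sum : Tm F K → Tm F K → Tm F K
  | inl : Tm F K → Tm F K
  | inr : Tm F K → Tm F K
  | sumInd : Tm F K → Tm F K → Tm F K → Tm F K → Tm F K
  -- `emptyInd C p`: `C` binds one
  | empty : Tm F K
  | emptyInd : Tm F K → Tm F K → Tm F K
  -- `unitInd C c p`: `C` binds one
  | unit : Tm F K
  | star : Tm F K
  | unitInd : Tm F K → Tm F K → Tm F K → Tm F K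
  -- `natInd C z s n`: `C` binds one, `s` binds two
  | nat : Tm F K
  | zero : Tm F K
  | succ : Tm F K → Tm F K
  | natInd : Tm F K → Tm F K → Tm F K → Tm F K → Tm F K
  -- `idt A a b` is `a =_A b`;  `idInd C c a b p`: `C` binds three, `c` binds one
  | idt : Tm F K → Tm F K → Tm F K → Tm F K
  | refl : Tm F K → Tm F K
  | idInd : Tm F K → Tm F K → Tm F K → Tm F K → Tm F K → Tm F K
  -- `♭_φ A`, `M^{♭_φ}`, and `let u^{♭_φ} := M in N`, where `N` binds one
  | flat : F → Tm F K → Tm F K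
  | flatIntro : F → Tm F K → Tm F K
  | flatInd : F → Tm F K → Tm F K → Tm F K
  -- `♯_φ A`, `M^{♯_φ}`, `N_{♯_φ}`
  | sharp : F → Tm F K → Tm F K
  | sharpIntro : F → Tm F K → Tm F K
  | sharpElim : F → Tm F K → Tm F K

namespace Tm

variable {F : Type u} {K : Type v}

/-- `openAt s k t` replaces the bound variable with index `k` in `t` by `s`.  It is used for terms
`s` without loose bound variables only. -/
def openAt (s : Tm F K) : ℕ → Tm F K → Tm F K
  | k, bvar n => if n = k then s else bvar n
  | _, fvar x => fvar x
  | _, con c => con c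
  | _, univ i => univ i
  | k, pi A B => pi (openAt s k A) (openAt s (k + 1) B)
  | k, lam A b => lam (openAt s k A) (openAt s (k + 1) b)
  | k, app f a => app (openAt s k f) (openAt s k a)
  | k, sigma A B => sigma (openAt s k A) (openAt s (k + 1) B)
  | k, pair a b => pair (openAt s k a) (openAt s k b)
  | k, sigmaInd C g p => sigmaInd (openAt s (k + 1) C) (openAt s (k + 2) g) (openAt s k p)
  | k, sum A B => sum (openAt s k A) (openAt s k B)
  | k, inl a => inl (openAt s k a)
  | k, inr b => inr (openAt s k b)
  | k, sumInd C l r p =>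
      sumInd (openAt s (k + 1) C) (openAt s (k + 1) l) (openAt s (k + 1) r) (openAt s k p)
  | _, empty => empty
  | k, emptyInd C p => emptyInd (openAt s (k + 1) C) (openAt s k p)
  | _, unit => unit
  | _, star => star
  | k, unitInd C c p => unitInd (openAt s (k + 1) C) (openAt s k c) (openAt s k p)
  | _, nat => nat
  | _, zero => zero
  | k, succ n => succ (openAt s k n)
  | k, natInd C z t n =>
      natInd (openAt s (k + 1) C) (openAt s k z) (openAt s (k + 2) t) (openAt s k n)
  | k, idt A a b => idt (openAt s k A) (openAt s k a) (openAt s k b)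
  | k, refl a => refl (openAt s k a)
  | k, idInd C c a b p =>
      idInd (openAt s (k + 3) C) (openAt s (k + 1) c) (openAt s k a) (openAt s k b) (openAt s k p)
  | k, flat φ A => flat φ (openAt s k A)
  | k, flatIntro φ M => flatIntro φ (openAt s k M)
  | k, flatInd φ M N => flatInd φ (openAt s k M) (openAt s (k + 1) N)
  | k, sharp φ A => sharp φ (openAt s k A)
  | k, sharpIntro φ M => sharpIntro φ (openAt s k M)
  | k, sharpElim φ N => sharpElim φ (openAt s k N)

/-- Instantiate the variable bound in `t`. -/
def open1 (t s : Tm F K) : Tm F K := openAt s 0 t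

/-- Instantiate the two variables bound in `t`. -/
def open2 (t s₁ s₂ : Tm F K) : Tm F K := openAt s₂ 0 (openAt s₁ 1 t)

/-- Instantiate the three variables bound in `t`. -/
def open3 (t s₁ s₂ s₃ : Tm F K) : Tm F K := openAt s₃ 0 (openAt s₂ 1 (openAt s₁ 2 t))

end Tm

/-- A declaration `name :_focus ty` in a context. -/
structure Entry (F : Type u) (K : Type v) where
  name : ℕ
  focus : F
  ty : Tm F K

/-- Contexts; the head of the list is the last declaration. -/
abbrev Cxt (F : Type u) (K : Type v) := List (Entry F K)

/-- `φ Γ`: the focus `φ` is added to the annotation of every variable. -/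
def Cxt.promote {F : Type u} {K : Type v} [SemilatticeInf F] (φ : F) (Γ : Cxt F K) : Cxt F K :=
  List.map (fun e => ⟨e.name, φ ⊓ e.focus, e.ty⟩) Γ

open Classical in
/-- `φ \ Γ`: the variables that are not `φ`-crisp are deleted. -/
noncomputable def Cxt.divide {F : Type u} {K : Type v} [SemilatticeInf F] (φ : F) (Γ : Cxt F K) :
    Cxt F K :=
  List.filter (fun e => decide (e.focus ≤ φ)) Γ

/-- The variables declared in a context. -/
def Cxt.names {F : Type u} {K : Type v} (Γ : Cxt F K) : List ℕ := List.map Entry.name Γ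

/-- Postulated closed constants `c : conTy c` and postulated closed definitional equations
`a ≡ b : A` (`Eqn a b A`), by which the theory may be extended: function extensionality,
univalence, higher inductive types, properties of particular focuses.  The pure type theory is the
case `K = Empty`, `Eqn = fun _ _ _ => False`. -/
structure Signature (F : Type u) (K : Type v) where
  conTy : K → Tm F K
  Eqn : Tm F K → Tm F K → Tm F K → Prop

/-- The judgements `Γ ctx`, `Γ ⊢ a : A` and `Γ ⊢ a ≡ b : A`. -/
inductive Judgment (F : Type u) (K : Type v) : Type (max u v)
  | ctx (Γ : Cxt F K)
  | tm (Γ : Cxt F K) (a A : Tm F K)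
  | eq (Γ : Cxt F K) (a b A : Tm F K)

open Tm in
/-- Derivability.  Premises about the body of a binder are required for all variables outside some
finite set `L`.  Some rules list premises that are otherwise left implicit: that the context of the
conclusion is a context, and that the types of new variables are types. -/
inductive Derivable {F : Type u} [SemilatticeInf F] [OrderTop F] {K : Type v}
    (S : Signature F K) : Judgment F K → Prop
  -- contexts and variables
  | ctx_empty : Derivable S (.ctx [])
  | ctx_ext {Γ : Cxt F K} {x : ℕ} {φ : F} {A : Tm F K} {i : ℕ} :
      Derivable S (.ctx Γ) → Derivable S (.tm (Γ.divide φ) A (univ i)) → x ∉ Γ.names →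
      Derivable S (.ctx (⟨x, φ, A⟩ :: Γ))
  | var {Γ : Cxt F K} {x : ℕ} {φ : F} {A : Tm F K} :
      Derivable S (.ctx Γ) → (⟨x, φ, A⟩ : Entry F K) ∈ Γ → Derivable S (.tm Γ (fvar x) A)
  -- definitional equality
  | eq_refl {Γ : Cxt F K} {a A : Tm F K} :
      Derivable S (.tm Γ a A) → Derivable S (.eq Γ a a A)
  | eq_symm {Γ : Cxt F K} {a b A : Tm F K} :
      Derivable S (.eq Γ a b A) → Derivable S (.eq Γ b a A)
  | eq_trans {Γ : Cxt F K} {a b c A : Tm F K} :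
      Derivable S (.eq Γ a b A) → Derivable S (.eq Γ b c A) → Derivable S (.eq Γ a c A)
  | conv {Γ : Cxt F K} {a A B : Tm F K} {i : ℕ} :
      Derivable S (.tm Γ a A) → Derivable S (.eq Γ A B (univ i)) → Derivable S (.tm Γ a B)
  | conv_eq {Γ : Cxt F K} {a b A B : Tm F K} {i : ℕ} :
      Derivable S (.eq Γ a b A) → Derivable S (.eq Γ A B (univ i)) → Derivable S (.eq Γ a b B)
  -- constants
  | con {Γ : Cxt F K} {c : K} {i : ℕ} :
      Derivable S (.ctx Γ) → Derivable S (.tm [] (S.conTy c) (univ i)) →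
      Derivable S (.tm Γ (con c) (S.conTy c))
  | con_eq {Γ : Cxt F K} {a b A : Tm F K} :
      Derivable S (.ctx Γ) → S.Eqn a b A → Derivable S (.tm [] a A) → Derivable S (.tm [] b A) →
      Derivable S (.eq Γ a b A)
  -- universes
  | univ {Γ : Cxt F K} {i : ℕ} :
      Derivable S (.ctx Γ) → Derivable S (.tm Γ (univ i) (univ (i + 1)))
  | cumul {Γ : Cxt F K} {A : Tm F K} {i : ℕ} :
      Derivable S (.tm Γ A (univ i)) → Derivable S (.tm Γ A (univ (i + 1)))
  | cumul_eq {Γ : Cxt F K} {A B : Tm F K} {i : ℕ} :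
      Derivable S (.eq Γ A B (univ i)) → Derivable S (.eq Γ A B (univ (i + 1)))
  -- dependent functions
  | pi_form {Γ : Cxt F K} {A B : Tm F K} {i : ℕ} (L : Finset ℕ) :
      Derivable S (.tm Γ A (univ i)) →
      (∀ x ∉ L, Derivable S (.tm (⟨x, ⊤, A⟩ :: Γ) (open1 B (fvar x)) (univ i))) →
      Derivable S (.tm Γ (pi A B) (univ i))
  | pi_intro {Γ : Cxt F K} {A B b : Tm F K} {i : ℕ} (L : Finset ℕ) :
      Derivable S (.tm Γ A (univ i)) →
      (∀ x ∉ L, Derivable S (.tm (⟨x, ⊤, A⟩ :: Γ) (open1 b (fvar x)) (open1 B (fvar x)))) →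
      Derivable S (.tm Γ (lam A b) (pi A B))
  | pi_elim {Γ : Cxt F K} {A B f a : Tm F K} :
      Derivable S (.tm Γ f (pi A B)) → Derivable S (.tm Γ a A) →
      Derivable S (.tm Γ (app f a) (open1 B a))
  | pi_beta {Γ : Cxt F K} {A B b a : Tm F K} {i : ℕ} (L : Finset ℕ) :
      Derivable S (.tm Γ A (univ i)) →
      (∀ x ∉ L, Derivable S (.tm (⟨x, ⊤, A⟩ :: Γ) (open1 b (fvar x)) (open1 B (fvar x)))) →
      Derivable S (.tm Γ a A) →
      Derivable S (.eq Γ (app (lam A b) a) (open1 b a) (open1 B a))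
  | pi_eta {Γ : Cxt F K} {A B f : Tm F K} :
      Derivable S (.tm Γ f (pi A B)) →
      Derivable S (.eq Γ f (lam A (app f (bvar 0))) (pi A B))
  | pi_form_cong {Γ : Cxt F K} {A A' B B' : Tm F K} {i : ℕ} (L : Finset ℕ) :
      Derivable S (.tm Γ A (univ i)) → Derivable S (.eq Γ A A' (univ i)) →
      (∀ x ∉ L, Derivable S
        (.eq (⟨x, ⊤, A⟩ :: Γ) (open1 B (fvar x)) (open1 B' (fvar x)) (univ i))) →
      Derivable S (.eq Γ (pi A B) (pi A' B') (univ i))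
  | pi_intro_cong {Γ : Cxt F K} {A A' B b b' : Tm F K} {i : ℕ} (L : Finset ℕ) :
      Derivable S (.tm Γ A (univ i)) → Derivable S (.eq Γ A A' (univ i)) →
      (∀ x ∉ L, Derivable S
        (.eq (⟨x, ⊤, A⟩ :: Γ) (open1 b (fvar x)) (open1 b' (fvar x)) (open1 B (fvar x)))) →
      Derivable S (.eq Γ (lam A b) (lam A' b') (pi A B))
  | pi_elim_cong {Γ : Cxt F K} {A B f f' a a' : Tm F K} :
      Derivable S (.eq Γ f f' (pi A B)) → Derivable S (.eq Γ a a' A) →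
      Derivable S (.eq Γ (app f a) (app f' a') (open1 B a))
  -- dependent pairs
  | sigma_form {Γ : Cxt F K} {A B : Tm F K} {i : ℕ} (L : Finset ℕ) :
      Derivable S (.tm Γ A (univ i)) →
      (∀ x ∉ L, Derivable S (.tm (⟨x, ⊤, A⟩ :: Γ) (open1 B (fvar x)) (univ i))) →
      Derivable S (.tm Γ (sigma A B) (univ i))
  | sigma_intro {Γ : Cxt F K} {A B a b : Tm F K} {i : ℕ} (L : Finset ℕ) :
      Derivable S (.tm Γ A (univ i)) →
      (∀ x ∉ L, Derivable S (.tm (⟨x, ⊤, A⟩ :: Γ) (open1 B (fvar x)) (univ i))) →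
      Derivable S (.tm Γ a A) → Derivable S (.tm Γ b (open1 B a)) →
      Derivable S (.tm Γ (pair a b) (sigma A B))
  | sigma_elim {Γ : Cxt F K} {A B C g p : Tm F K} {i j : ℕ} (L : Finset ℕ) :
      Derivable S (.tm Γ A (univ i)) →
      (∀ x ∉ L, Derivable S (.tm (⟨x, ⊤, A⟩ :: Γ) (open1 B (fvar x)) (univ i))) →
      (∀ z ∉ L, Derivable S (.tm (⟨z, ⊤, sigma A B⟩ :: Γ) (open1 C (fvar z)) (univ j))) →
      (∀ x ∉ L, ∀ y ∉ L, x ≠ y → Derivable S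
        (.tm (⟨y, ⊤, open1 B (fvar x)⟩ :: ⟨x, ⊤, A⟩ :: Γ) (open2 g (fvar x) (fvar y))
          (open1 C (pair (fvar x) (fvar y))))) →
      Derivable S (.tm Γ p (sigma A B)) →
      Derivable S (.tm Γ (sigmaInd C g p) (open1 C p))
  | sigma_beta {Γ : Cxt F K} {A B C g a b : Tm F K} {i j : ℕ} (L : Finset ℕ) :
      Derivable S (.tm Γ A (univ i)) →
      (∀ x ∉ L, Derivable S (.tm (⟨x, ⊤, A⟩ :: Γ) (open1 B (fvar x)) (univ i))) →
      (∀ z ∉ L, Derivable S (.tm (⟨z, ⊤, sigma A B⟩ :: Γ) (open1 C (fvar z)) (univ j))) →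
      (∀ x ∉ L, ∀ y ∉ L, x ≠ y → Derivable S
        (.tm (⟨y, ⊤, open1 B (fvar x)⟩ :: ⟨x, ⊤, A⟩ :: Γ) (open2 g (fvar x) (fvar y))
          (open1 C (pair (fvar x) (fvar y))))) →
      Derivable S (.tm Γ a A) → Derivable S (.tm Γ b (open1 B a)) →
      Derivable S (.eq Γ (sigmaInd C g (pair a b)) (open2 g a b) (open1 C (pair a b)))
  | sigma_form_cong {Γ : Cxt F K} {A A' B B' : Tm F K} {i : ℕ} (L : Finset ℕ) :
      Derivable S (.tm Γ A (univ i)) → Derivable S (.eq Γ A A' (univ i)) →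
      (∀ x ∉ L, Derivable S
        (.eq (⟨x, ⊤, A⟩ :: Γ) (open1 B (fvar x)) (open1 B' (fvar x)) (univ i))) →
      Derivable S (.eq Γ (sigma A B) (sigma A' B') (univ i))
  | sigma_intro_cong {Γ : Cxt F K} {A B a a' b b' : Tm F K} {i : ℕ} (L : Finset ℕ) :
      Derivable S (.tm Γ A (univ i)) →
      (∀ x ∉ L, Derivable S (.tm (⟨x, ⊤, A⟩ :: Γ) (open1 B (fvar x)) (univ i))) →
      Derivable S (.eq Γ a a' A) → Derivable S (.eq Γ b b' (open1 B a)) →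
      Derivable S (.eq Γ (pair a b) (pair a' b') (sigma A B))
  | sigma_elim_cong {Γ : Cxt F K} {A B C C' g g' p p' : Tm F K} {i j : ℕ} (L : Finset ℕ) :
      Derivable S (.tm Γ A (univ i)) →
      (∀ x ∉ L, Derivable S (.tm (⟨x, ⊤, A⟩ :: Γ) (open1 B (fvar x)) (univ i))) →
      (∀ z ∉ L, Derivable S
        (.eq (⟨z, ⊤, sigma A B⟩ :: Γ) (open1 C (fvar z)) (open1 C' (fvar z)) (univ j))) →
      (∀ x ∉ L, ∀ y ∉ L, x ≠ y → Derivable S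
        (.eq (⟨y, ⊤, open1 B (fvar x)⟩ :: ⟨x, ⊤, A⟩ :: Γ) (open2 g (fvar x) (fvar y))
          (open2 g' (fvar x) (fvar y)) (open1 C (pair (fvar x) (fvar y))))) →
      Derivable S (.eq Γ p p' (sigma A B)) →
      Derivable S (.eq Γ (sigmaInd C g p) (sigmaInd C' g' p') (open1 C p))
  -- binary sums
  | sum_form {Γ : Cxt F K} {A B : Tm F K} {i : ℕ} :
      Derivable S (.tm Γ A (univ i)) → Derivable S (.tm Γ B (univ i)) →
      Derivable S (.tm Γ (sum A B) (univ i))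
  | sum_inl {Γ : Cxt F K} {A B a : Tm F K} {i : ℕ} :
      Derivable S (.tm Γ A (univ i)) → Derivable S (.tm Γ B (univ i)) →
      Derivable S (.tm Γ a A) → Derivable S (.tm Γ (inl a) (sum A B))
  | sum_inr {Γ : Cxt F K} {A B b : Tm F K} {i : ℕ} :
      Derivable S (.tm Γ A (univ i)) → Derivable S (.tm Γ B (univ i)) →
      Derivable S (.tm Γ b B) → Derivable S (.tm Γ (inr b) (sum A B))
  | sum_elim {Γ : Cxt F K} {A B C l r p : Tm F K} {i j : ℕ} (L : Finset ℕ) :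
      Derivable S (.tm Γ A (univ i)) → Derivable S (.tm Γ B (univ i)) →
      (∀ z ∉ L, Derivable S (.tm (⟨z, ⊤, sum A B⟩ :: Γ) (open1 C (fvar z)) (univ j))) →
      (∀ x ∉ L, Derivable S
        (.tm (⟨x, ⊤, A⟩ :: Γ) (open1 l (fvar x)) (open1 C (inl (fvar x))))) →
      (∀ y ∉ L, Derivable S
        (.tm (⟨y, ⊤, B⟩ :: Γ) (open1 r (fvar y)) (open1 C (inr (fvar y))))) →
      Derivable S (.tm Γ p (sum A B)) →
      Derivable S (.tm Γ (sumInd C l r p) (open1 C p))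
  | sum_beta_inl {Γ : Cxt F K} {A B C l r a : Tm F K} {i j : ℕ} (L : Finset ℕ) :
      Derivable S (.tm Γ A (univ i)) → Derivable S (.tm Γ B (univ i)) →
      (∀ z ∉ L, Derivable S (.tm (⟨z, ⊤, sum A B⟩ :: Γ) (open1 C (fvar z)) (univ j))) →
      (∀ x ∉ L, Derivable S
        (.tm (⟨x, ⊤, A⟩ :: Γ) (open1 l (fvar x)) (open1 C (inl (fvar x))))) →
      (∀ y ∉ L, Derivable S
        (.tm (⟨y, ⊤, B⟩ :: Γ) (open1 r (fvar y)) (open1 C (inr (fvar y))))) →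
      Derivable S (.tm Γ a A) →
      Derivable S (.eq Γ (sumInd C l r (inl a)) (open1 l a) (open1 C (inl a)))
  | sum_beta_inr {Γ : Cxt F K} {A B C l r b : Tm F K} {i j : ℕ} (L : Finset ℕ) :
      Derivable S (.tm Γ A (univ i)) → Derivable S (.tm Γ B (univ i)) →
      (∀ z ∉ L, Derivable S (.tm (⟨z, ⊤, sum A B⟩ :: Γ) (open1 C (fvar z)) (univ j))) →
      (∀ x ∉ L, Derivable S
        (.tm (⟨x, ⊤, A⟩ :: Γ) (open1 l (fvar x)) (open1 C (inl (fvar x))))) →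
      (∀ y ∉ L, Derivable S
        (.tm (⟨y, ⊤, B⟩ :: Γ) (open1 r (fvar y)) (open1 C (inr (fvar y))))) →
      Derivable S (.tm Γ b B) →
      Derivable S (.eq Γ (sumInd C l r (inr b)) (open1 r b) (open1 C (inr b)))
  | sum_form_cong {Γ : Cxt F K} {A A' B B' : Tm F K} {i : ℕ} :
      Derivable S (.eq Γ A A' (univ i)) → Derivable S (.eq Γ B B' (univ i)) →
      Derivable S (.eq Γ (sum A B) (sum A' B') (univ i))
  | sum_inl_cong {Γ : Cxt F K} {A B a a' : Tm F K} {i : ℕ} :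
      Derivable S (.tm Γ A (univ i)) → Derivable S (.tm Γ B (univ i)) →
      Derivable S (.eq Γ a a' A) → Derivable S (.eq Γ (inl a) (inl a') (sum A B))
  | sum_inr_cong {Γ : Cxt F K} {A B b b' : Tm F K} {i : ℕ} :
      Derivable S (.tm Γ A (univ i)) → Derivable S (.tm Γ B (univ i)) →
      Derivable S (.eq Γ b b' B) → Derivable S (.eq Γ (inr b) (inr b') (sum A B))
  | sum_elim_cong {Γ : Cxt F K} {A B C C' l l' r r' p p' : Tm F K} {i j : ℕ} (L : Finset ℕ) :
      Derivable S (.tm Γ A (univ i)) → Derivable S (.tm Γ B (univ i)) →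
      (∀ z ∉ L, Derivable S
        (.eq (⟨z, ⊤, sum A B⟩ :: Γ) (open1 C (fvar z)) (open1 C' (fvar z)) (univ j))) →
      (∀ x ∉ L, Derivable S
        (.eq (⟨x, ⊤, A⟩ :: Γ) (open1 l (fvar x)) (open1 l' (fvar x))
          (open1 C (inl (fvar x))))) →
      (∀ y ∉ L, Derivable S
        (.eq (⟨y, ⊤, B⟩ :: Γ) (open1 r (fvar y)) (open1 r' (fvar y))
          (open1 C (inr (fvar y))))) →
      Derivable S (.eq Γ p p' (sum A B)) →
      Derivable S (.eq Γ (sumInd C l r p) (sumInd C' l' r' p') (open1 C p))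
  -- the empty type
  | empty_form {Γ : Cxt F K} {i : ℕ} :
      Derivable S (.ctx Γ) → Derivable S (.tm Γ empty (univ i))
  | empty_elim {Γ : Cxt F K} {C p : Tm F K} {j : ℕ} (L : Finset ℕ) :
      (∀ z ∉ L, Derivable S (.tm (⟨z, ⊤, empty⟩ :: Γ) (open1 C (fvar z)) (univ j))) →
      Derivable S (.tm Γ p empty) → Derivable S (.tm Γ (emptyInd C p) (open1 C p))
  | empty_elim_cong {Γ : Cxt F K} {C C' p p' : Tm F K} {j : ℕ} (L : Finset ℕ) :
      (∀ z ∉ L, Derivable S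
        (.eq (⟨z, ⊤, empty⟩ :: Γ) (open1 C (fvar z)) (open1 C' (fvar z)) (univ j))) →
      Derivable S (.eq Γ p p' empty) →
      Derivable S (.eq Γ (emptyInd C p) (emptyInd C' p') (open1 C p))
  -- the unit type
  | unit_form {Γ : Cxt F K} {i : ℕ} :
      Derivable S (.ctx Γ) → Derivable S (.tm Γ unit (univ i))
  | unit_intro {Γ : Cxt F K} :
      Derivable S (.ctx Γ) → Derivable S (.tm Γ star unit)
  | unit_elim {Γ : Cxt F K} {C c p : Tm F K} {j : ℕ} (L : Finset ℕ) :
      (∀ z ∉ L, Derivable S (.tm (⟨z, ⊤, unit⟩ :: Γ) (open1 C (fvar z)) (univ j))) →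
      Derivable S (.tm Γ c (open1 C star)) → Derivable S (.tm Γ p unit) →
      Derivable S (.tm Γ (unitInd C c p) (open1 C p))
  | unit_beta {Γ : Cxt F K} {C c : Tm F K} {j : ℕ} (L : Finset ℕ) :
      (∀ z ∉ L, Derivable S (.tm (⟨z, ⊤, unit⟩ :: Γ) (open1 C (fvar z)) (univ j))) →
      Derivable S (.tm Γ c (open1 C star)) →
      Derivable S (.eq Γ (unitInd C c star) c (open1 C star))
  | unit_elim_cong {Γ : Cxt F K} {C C' c c' p p' : Tm F K} {j : ℕ} (L : Finset ℕ) :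
      (∀ z ∉ L, Derivable S
        (.eq (⟨z, ⊤, unit⟩ :: Γ) (open1 C (fvar z)) (open1 C' (fvar z)) (univ j))) →
      Derivable S (.eq Γ c c' (open1 C star)) → Derivable S (.eq Γ p p' unit) →
      Derivable S (.eq Γ (unitInd C c p) (unitInd C' c' p') (open1 C p))
  -- the natural numbers
  | nat_form {Γ : Cxt F K} {i : ℕ} :
      Derivable S (.ctx Γ) → Derivable S (.tm Γ nat (univ i))
  | nat_zero {Γ : Cxt F K} :
      Derivable S (.ctx Γ) → Derivable S (.tm Γ zero nat)
  | nat_succ {Γ : Cxt F K} {n : Tm F K} :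
      Derivable S (.tm Γ n nat) → Derivable S (.tm Γ (succ n) nat)
  | nat_elim {Γ : Cxt F K} {C z s n : Tm F K} {j : ℕ} (L : Finset ℕ) :
      (∀ x ∉ L, Derivable S (.tm (⟨x, ⊤, nat⟩ :: Γ) (open1 C (fvar x)) (univ j))) →
      Derivable S (.tm Γ z (open1 C zero)) →
      (∀ x ∉ L, ∀ y ∉ L, x ≠ y → Derivable S
        (.tm (⟨y, ⊤, open1 C (fvar x)⟩ :: ⟨x, ⊤, nat⟩ :: Γ) (open2 s (fvar x) (fvar y))
          (open1 C (succ (fvar x))))) →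
      Derivable S (.tm Γ n nat) →
      Derivable S (.tm Γ (natInd C z s n) (open1 C n))
  | nat_beta_zero {Γ : Cxt F K} {C z s : Tm F K} {j : ℕ} (L : Finset ℕ) :
      (∀ x ∉ L, Derivable S (.tm (⟨x, ⊤, nat⟩ :: Γ) (open1 C (fvar x)) (univ j))) →
      Derivable S (.tm Γ z (open1 C zero)) →
      (∀ x ∉ L, ∀ y ∉ L, x ≠ y → Derivable S
        (.tm (⟨y, ⊤, open1 C (fvar x)⟩ :: ⟨x, ⊤, nat⟩ :: Γ) (open2 s (fvar x) (fvar y))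
          (open1 C (succ (fvar x))))) →
      Derivable S (.eq Γ (natInd C z s zero) z (open1 C zero))
  | nat_beta_succ {Γ : Cxt F K} {C z s n : Tm F K} {j : ℕ} (L : Finset ℕ) :
      (∀ x ∉ L, Derivable S (.tm (⟨x, ⊤, nat⟩ :: Γ) (open1 C (fvar x)) (univ j))) →
      Derivable S (.tm Γ z (open1 C zero)) →
      (∀ x ∉ L, ∀ y ∉ L, x ≠ y → Derivable S
        (.tm (⟨y, ⊤, open1 C (fvar x)⟩ :: ⟨x, ⊤, nat⟩ :: Γ) (open2 s (fvar x) (fvar y))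
          (open1 C (succ (fvar x))))) →
      Derivable S (.tm Γ n nat) →
      Derivable S
        (.eq Γ (natInd C z s (succ n)) (open2 s n (natInd C z s n)) (open1 C (succ n)))
  | nat_succ_cong {Γ : Cxt F K} {n n' : Tm F K} :
      Derivable S (.eq Γ n n' nat) → Derivable S (.eq Γ (succ n) (succ n') nat)
  | nat_elim_cong {Γ : Cxt F K} {C C' z z' s s' n n' : Tm F K} {j : ℕ} (L : Finset ℕ) :
      (∀ x ∉ L, Derivable S (.tm (⟨x, ⊤, nat⟩ :: Γ) (open1 C (fvar x)) (univ j))) →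
      (∀ x ∉ L, Derivable S
        (.eq (⟨x, ⊤, nat⟩ :: Γ) (open1 C (fvar x)) (open1 C' (fvar x)) (univ j))) →
      Derivable S (.eq Γ z z' (open1 C zero)) →
      (∀ x ∉ L, ∀ y ∉ L, x ≠ y → Derivable S
        (.eq (⟨y, ⊤, open1 C (fvar x)⟩ :: ⟨x, ⊤, nat⟩ :: Γ) (open2 s (fvar x) (fvar y))
          (open2 s' (fvar x) (fvar y)) (open1 C (succ (fvar x))))) →
      Derivable S (.eq Γ n n' nat) →
      Derivable S (.eq Γ (natInd C z s n) (natInd C' z' s' n') (open1 C n))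
  -- identity types
  | id_form {Γ : Cxt F K} {A a b : Tm F K} {i : ℕ} :
      Derivable S (.tm Γ A (univ i)) → Derivable S (.tm Γ a A) → Derivable S (.tm Γ b A) →
      Derivable S (.tm Γ (idt A a b) (univ i))
  | id_intro {Γ : Cxt F K} {A a : Tm F K} {i : ℕ} :
      Derivable S (.tm Γ A (univ i)) → Derivable S (.tm Γ a A) →
      Derivable S (.tm Γ (refl a) (idt A a a))
  | id_elim {Γ : Cxt F K} {A C c a b p : Tm F K} {i j : ℕ} (L : Finset ℕ) :
      Derivable S (.tm Γ A (univ i)) →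
      (∀ x ∉ L, ∀ y ∉ L, ∀ q ∉ L, x ≠ y → x ≠ q → y ≠ q → Derivable S
        (.tm (⟨q, ⊤, idt A (fvar x) (fvar y)⟩ :: ⟨y, ⊤, A⟩ :: ⟨x, ⊤, A⟩ :: Γ)
          (open3 C (fvar x) (fvar y) (fvar q)) (univ j))) →
      (∀ z ∉ L, Derivable S
        (.tm (⟨z, ⊤, A⟩ :: Γ) (open1 c (fvar z)) (open3 C (fvar z) (fvar z) (refl (fvar z))))) →
      Derivable S (.tm Γ a A) → Derivable S (.tm Γ b A) → Derivable S (.tm Γ p (idt A a b)) →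
      Derivable S (.tm Γ (idInd C c a b p) (open3 C a b p))
  | id_beta {Γ : Cxt F K} {A C c a : Tm F K} {i j : ℕ} (L : Finset ℕ) :
      Derivable S (.tm Γ A (univ i)) →
      (∀ x ∉ L, ∀ y ∉ L, ∀ q ∉ L, x ≠ y → x ≠ q → y ≠ q → Derivable S
        (.tm (⟨q, ⊤, idt A (fvar x) (fvar y)⟩ :: ⟨y, ⊤, A⟩ :: ⟨x, ⊤, A⟩ :: Γ)
          (open3 C (fvar x) (fvar y) (fvar q)) (univ j))) →
      (∀ z ∉ L, Derivable S
        (.tm (⟨z, ⊤, A⟩ :: Γ) (open1 c (fvar z)) (open3 C (fvar z) (fvar z) (refl (fvar z))))) →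
      Derivable S (.tm Γ a A) →
      Derivable S (.eq Γ (idInd C c a a (refl a)) (open1 c a) (open3 C a a (refl a)))
  | id_form_cong {Γ : Cxt F K} {A A' a a' b b' : Tm F K} {i : ℕ} :
      Derivable S (.eq Γ A A' (univ i)) → Derivable S (.eq Γ a a' A) →
      Derivable S (.eq Γ b b' A) →
      Derivable S (.eq Γ (idt A a b) (idt A' a' b') (univ i))
  | id_intro_cong {Γ : Cxt F K} {A a a' : Tm F K} {i : ℕ} :
      Derivable S (.tm Γ A (univ i)) → Derivable S (.eq Γ a a' A) →
      Derivable S (.eq Γ (refl a) (refl a') (idt A a a))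
  | id_elim_cong {Γ : Cxt F K} {A C C' c c' a a' b b' p p' : Tm F K} {i j : ℕ} (L : Finset ℕ) :
      Derivable S (.tm Γ A (univ i)) →
      (∀ x ∉ L, ∀ y ∉ L, ∀ q ∉ L, x ≠ y → x ≠ q → y ≠ q → Derivable S
        (.eq (⟨q, ⊤, idt A (fvar x) (fvar y)⟩ :: ⟨y, ⊤, A⟩ :: ⟨x, ⊤, A⟩ :: Γ)
          (open3 C (fvar x) (fvar y) (fvar q)) (open3 C' (fvar x) (fvar y) (fvar q))
          (univ j))) →
      (∀ z ∉ L, Derivable S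
        (.eq (⟨z, ⊤, A⟩ :: Γ) (open1 c (fvar z)) (open1 c' (fvar z))
          (open3 C (fvar z) (fvar z) (refl (fvar z))))) →
      Derivable S (.eq Γ a a' A) → Derivable S (.eq Γ b b' A) →
      Derivable S (.eq Γ p p' (idt A a b)) →
      Derivable S (.eq Γ (idInd C c a b p) (idInd C' c' a' b' p') (open3 C a b p))
  -- the comodality `♭_φ`
  | flat_form {Γ : Cxt F K} {φ : F} {A : Tm F K} {i : ℕ} :
      Derivable S (.ctx Γ) → Derivable S (.tm (Γ.divide φ) A (univ i)) →
      Derivable S (.tm Γ (flat φ A) (univ i))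
  | flat_intro {Γ : Cxt F K} {φ : F} {A M : Tm F K} :
      Derivable S (.ctx Γ) → Derivable S (.tm (Γ.divide φ) M A) →
      Derivable S (.tm Γ (flatIntro φ M) (flat φ A))
  -- `ψ`-crisp `♭_φ`-induction
  | flat_elim {Γ : Cxt F K} {φ ψ : F} {A C M N : Tm F K} {i j : ℕ} (L : Finset ℕ) :
      Derivable S (.tm (Γ.divide (ψ ⊓ φ)) A (univ i)) →
      (∀ x ∉ L, Derivable S (.tm (⟨x, ψ, flat φ A⟩ :: Γ) (open1 C (fvar x)) (univ j))) →
      Derivable S (.tm (Γ.divide ψ) M (flat φ A)) →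
      (∀ y ∉ L, Derivable S (.tm (⟨y, ψ ⊓ φ, A⟩ :: Γ) (open1 N (fvar y))
        (open1 C (flatIntro φ (fvar y))))) →
      Derivable S (.tm Γ (flatInd φ M N) (open1 C M))
  | flat_beta {Γ : Cxt F K} {φ ψ : F} {A C M N : Tm F K} {i j : ℕ} (L : Finset ℕ) :
      Derivable S (.tm (Γ.divide (ψ ⊓ φ)) A (univ i)) →
      (∀ x ∉ L, Derivable S (.tm (⟨x, ψ, flat φ A⟩ :: Γ) (open1 C (fvar x)) (univ j))) →
      Derivable S (.tm (Γ.divide (ψ ⊓ φ)) M A) →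
      (∀ y ∉ L, Derivable S (.tm (⟨y, ψ ⊓ φ, A⟩ :: Γ) (open1 N (fvar y))
        (open1 C (flatIntro φ (fvar y))))) →
      Derivable S (.eq Γ (flatInd φ (flatIntro φ M) N) (open1 N M) (open1 C (flatIntro φ M)))
  | flat_form_cong {Γ : Cxt F K} {φ : F} {A A' : Tm F K} {i : ℕ} :
      Derivable S (.ctx Γ) → Derivable S (.eq (Γ.divide φ) A A' (univ i)) →
      Derivable S (.eq Γ (flat φ A) (flat φ A') (univ i))
  | flat_intro_cong {Γ : Cxt F K} {φ : F} {A M M' : Tm F K} :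
      Derivable S (.ctx Γ) → Derivable S (.eq (Γ.divide φ) M M' A) →
      Derivable S (.eq Γ (flatIntro φ M) (flatIntro φ M') (flat φ A))
  | flat_elim_cong {Γ : Cxt F K} {φ ψ : F} {A C M M' N N' : Tm F K} {i j : ℕ} (L : Finset ℕ) :
      Derivable S (.tm (Γ.divide (ψ ⊓ φ)) A (univ i)) →
      (∀ x ∉ L, Derivable S (.tm (⟨x, ψ, flat φ A⟩ :: Γ) (open1 C (fvar x)) (univ j))) →
      Derivable S (.eq (Γ.divide ψ) M M' (flat φ A)) →
      (∀ y ∉ L, Derivable S (.eq (⟨y, ψ ⊓ φ, A⟩ :: Γ) (open1 N (fvar y)) (open1 N' (fvar y))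
        (open1 C (flatIntro φ (fvar y))))) →
      Derivable S (.eq Γ (flatInd φ M N) (flatInd φ M' N') (open1 C M))
  -- the modality `♯_φ`
  | sharp_form {Γ : Cxt F K} {φ : F} {A : Tm F K} {i : ℕ} :
      Derivable S (.ctx Γ) → Derivable S (.tm (Γ.promote φ) A (univ i)) →
      Derivable S (.tm Γ (sharp φ A) (univ i))
  | sharp_intro {Γ : Cxt F K} {φ : F} {A M : Tm F K} :
      Derivable S (.ctx Γ) → Derivable S (.tm (Γ.promote φ) M A) →
      Derivable S (.tm Γ (sharpIntro φ M) (sharp φ A))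
  | sharp_elim {Γ : Cxt F K} {φ : F} {A N : Tm F K} :
      Derivable S (.ctx Γ) → Derivable S (.tm (Γ.divide φ) N (sharp φ A)) →
      Derivable S (.tm Γ (sharpElim φ N) A)
  | sharp_beta {Γ : Cxt F K} {φ : F} {A M : Tm F K} :
      Derivable S (.ctx Γ) → Derivable S (.tm (Γ.divide φ) M A) →
      Derivable S (.eq Γ (sharpElim φ (sharpIntro φ M)) M A)
  | sharp_eta {Γ : Cxt F K} {φ : F} {A N : Tm F K} :
      Derivable S (.tm Γ N (sharp φ A)) →
      Derivable S (.eq Γ N (sharpIntro φ (sharpElim φ N)) (sharp φ A))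
  | sharp_form_cong {Γ : Cxt F K} {φ : F} {A A' : Tm F K} {i : ℕ} :
      Derivable S (.ctx Γ) → Derivable S (.eq (Γ.promote φ) A A' (univ i)) →
      Derivable S (.eq Γ (sharp φ A) (sharp φ A') (univ i))
  | sharp_intro_cong {Γ : Cxt F K} {φ : F} {A M M' : Tm F K} :
      Derivable S (.ctx Γ) → Derivable S (.eq (Γ.promote φ) M M' A) →
      Derivable S (.eq Γ (sharpIntro φ M) (sharpIntro φ M') (sharp φ A))
  | sharp_elim_cong {Γ : Cxt F K} {φ : F} {A N N' : Tm F K} :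
      Derivable S (.ctx Γ) → Derivable S (.eq (Γ.divide φ) N N' (sharp φ A)) →
      Derivable S (.eq Γ (sharpElim φ N) (sharpElim φ N') A)

namespace Signature

variable {F : Type u} [SemilatticeInf F] [OrderTop F] {K : Type v} (S : Signature F K)

/-- `Γ ctx` -/
def IsCtx (Γ : Cxt F K) : Prop := Derivable S (.ctx Γ)

/-- `Γ ⊢ A type` -/
def IsType (Γ : Cxt F K) (A : Tm F K) : Prop := ∃ i : ℕ, Derivable S (.tm Γ A (.univ i))

/-- `Γ ⊢ a : A` -/
def HasType (Γ : Cxt F K) (a A : Tm F K) : Prop := Derivable S (.tm Γ a A)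

/-- `Γ ⊢ a ≡ b : A` -/
def DefEq (Γ : Cxt F K) (a b A : Tm F K) : Prop := Derivable S (.eq Γ a b A)

/-- Some term has the type `A` in the context `Γ`. -/
def Inhabited (Γ : Cxt F K) (A : Tm F K) : Prop := ∃ a : Tm F K, S.HasType Γ a A

end Signature

/-! Derived notions.  Their arguments are terms without loose bound variables. -/

namespace Tm

variable {F : Type u} {K : Type v}

/-- `A → B` -/
def arrow (A B : Tm F K) : Tm F K := pi A B

/-- `A × B` -/
def prod (A B : Tm F K) : Tm F K := sigma A B

/-- The type of proofs that `f : A → B` is an equivalence (has a left and a right inverse):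
`(Σ (g : B → A), Π (x : A), g (f x) = x) × (Σ (h : B → A), Π (y : B), f (h y) = y)`. -/
def isEquiv (A B f : Tm F K) : Tm F K :=
  prod
    (sigma (arrow B A) (pi A (idt A (app (bvar 1) (app f (bvar 0))) (bvar 0))))
    (sigma (arrow B A) (pi B (idt B (app f (app (bvar 1) (bvar 0))) (bvar 0))))

/-- The identity function `λ (x : A). x`. -/
def idFun (A : Tm F K) : Tm F K := lam A (bvar 0)

/-- The composite `λ (x : A). g (f x)`. -/
def comp (A g f : Tm F K) : Tm F K := lam A (app g (app f (bvar 0)))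

/-- The action of `♭_φ` on a `φ`-crisp function `f` with domain `A`:
`λ (u : ♭_φ A). let v^{♭_φ} := u in (f v)^{♭_φ}`. -/
def flatMap (φ : F) (A f : Tm F K) : Tm F K :=
  lam (flat φ A) (flatInd φ (bvar 0) (flatIntro φ (app f (bvar 0))))

/-- `♭_φ (♭_ψ f) : ♭_φ ♭_ψ A → ♭_φ ♭_ψ B` for `f : A → B`. -/
def flatFlatMap (φ ψ : F) (A f : Tm F K) : Tm F K :=
  flatMap φ (flat ψ A) (flatMap ψ A f)

/-- The map `♭_φ ♭_ψ A → ♭_ψ ♭_φ A`,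
`u ↦ let v^{♭_φ} := u in (let w^{♭_ψ} := v in (w^{♭_φ})^{♭_ψ})`. -/
def flatComm (φ ψ : F) (A : Tm F K) : Tm F K :=
  lam (flat φ (flat ψ A))
    (flatInd φ (bvar 0) (flatInd ψ (bvar 0) (flatIntro ψ (flatIntro φ (bvar 0)))))

/-- The map `♯_φ ♯_ψ B → ♯_ψ ♯_φ B`, `x ↦ (((x_{♯_φ})_{♯_ψ})^{♯_φ})^{♯_ψ}`. -/
def sharpComm (φ ψ : F) (B : Tm F K) : Tm F K :=
  lam (sharp φ (sharp ψ B))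
    (sharpIntro ψ (sharpIntro φ (sharpElim ψ (sharpElim φ (bvar 0)))))

/-- The map `♯_φ ♯_ψ B → ♯_{φ ψ} B`, `x ↦ ((x_{♯_φ})_{♯_ψ})^{♯_{φ ψ}}`. -/
def sharpMerge [SemilatticeInf F] (φ ψ : F) (B : Tm F K) : Tm F K :=
  lam (sharp φ (sharp ψ B)) (sharpIntro (φ ⊓ ψ) (sharpElim ψ (sharpElim φ (bvar 0))))

/-- The map `♯_{φ ψ} B → ♯_φ ♯_ψ B`, `x ↦ ((x_{♯_{φ ψ}})^{♯_ψ})^{♯_φ}`. -/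
def sharpSplit [SemilatticeInf F] (φ ψ : F) (B : Tm F K) : Tm F K :=
  lam (sharp (φ ⊓ ψ) B) (sharpIntro φ (sharpIntro ψ (sharpElim (φ ⊓ ψ) (bvar 0))))

end Tm

/-- `f : A → B` and `g : B → A` are definitionally inverse to each other in the context `Γ`:
`g ∘ f ≡ id` and `f ∘ g ≡ id`. -/
def Signature.DefInverse {F : Type u} [SemilatticeInf F] [OrderTop F] {K : Type v}
    (S : Signature F K) (Γ : Cxt F K) (A B f g : Tm F K) : Prop :=
  S.HasType Γ f (Tm.arrow A B) ∧
  S.HasType Γ g (Tm.arrow B A) ∧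
  S.DefEq Γ (Tm.comp A g f) (Tm.idFun A) (Tm.arrow A A) ∧
  S.DefEq Γ (Tm.comp B f g) (Tm.idFun B) (Tm.arrow B B)

/-!
The theorem is a statement about derivability, so it is proved by exhibiting terms and deriving
their typing and equality judgements.  No substitution lemma is needed, since the `β`-rules carry
substitution with them; two structural properties are.

* Derivable terms are locally closed (`Derivable.lc`), so that opening a binder leaves the ambient
  types and functions unchanged.
* Judgements can be transported from `Γ` to every context `Δ` that declares the variables of `Γ`
  with the same types and with focuses that are equal or smaller (`Cxt.Sub`,
  `Derivable.weaken`).  This covers weakening, the passage from `φ \ Γ` to `Γ` and the passage from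
  `Γ` to `φ Γ`.  The rules for `♯_φ` require `φ Δ` to be a context, and that is itself a
  consequence of transport, for derivations that are not part of the one under consideration.  So
  transport is first proved into contexts all of whose refocusings are well-formed
  (`Cxt.Stable`, `Derivable.weakens`), and then every context is seen to be of this kind
  (`Derivable.stable`).

For the comodalities, `♭_φ`-induction followed by `φ`-crisp `♭_ψ`-induction reduces a homotopy
between functions on `♭_φ ♭_ψ A` to the elements `(w^{♭_ψ})^{♭_φ}` with `w` a `φψ`-crisp variable
(`Derivable.inhabited_pi_flat_flat`).  There both the round trip
(`Derivable.flatComm_flatComm`) and the naturality square (`Derivable.flatComm_natural`) hold by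
computation, so reflexivity proves them.

For the modalities, every variable of `φψ Γ` is both `φ`- and `ψ`-crisp, so `♯_φ` and `♯_ψ` can be
eliminated there without restriction (`Derivable.sharpElim_promote`).  Hence the round trips
reduce to the identity by `β` inside the introductions, followed by `η`; definitionally inverse
functions are equivalences (`Derivable.isEquiv_and_defInverse`).
-/

/-! ### Locally closed terms -/

namespace Tm

variable {F : Type u} {K : Type v}

/-- All loose bound variables of the term have an index below `k`.  The terms with `LcAt 0` are
the locally closed ones. -/
def LcAt : ℕ → Tm F K → Prop
  | k, bvar n => n < k
  | _, fvar _ => True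
  | _, con _ => True
  | _, univ _ => True
  | k, pi A B => LcAt k A ∧ LcAt (k + 1) B
  | k, lam A b => LcAt k A ∧ LcAt (k + 1) b
  | k, app f a => LcAt k f ∧ LcAt k a
  | k, sigma A B => LcAt k A ∧ LcAt (k + 1) B
  | k, pair a b => LcAt k a ∧ LcAt k b
  | k, sigmaInd C g p => LcAt (k + 1) C ∧ LcAt (k + 2) g ∧ LcAt k p
  | k, sum A B => LcAt k A ∧ LcAt k B
  | k, inl a => LcAt k a
  | k, inr b => LcAt k b
  | k, sumInd C l r p => LcAt (k + 1) C ∧ LcAt (k + 1) l ∧ LcAt (k + 1) r ∧ LcAt k p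
  | _, empty => True
  | k, emptyInd C p => LcAt (k + 1) C ∧ LcAt k p
  | _, unit => True
  | _, star => True
  | k, unitInd C c p => LcAt (k + 1) C ∧ LcAt k c ∧ LcAt k p
  | _, nat => True
  | _, zero => True
  | k, succ n => LcAt k n
  | k, natInd C z t n => LcAt (k + 1) C ∧ LcAt k z ∧ LcAt (k + 2) t ∧ LcAt k n
  | k, idt A a b => LcAt k A ∧ LcAt k a ∧ LcAt k b
  | k, refl a => LcAt k a
  | k, idInd C c a b p => LcAt (k + 3) C ∧ LcAt (k + 1) c ∧ LcAt k a ∧ LcAt k b ∧ LcAt k p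
  | k, flat _ A => LcAt k A
  | k, flatIntro _ M => LcAt k M
  | k, flatInd _ M N => LcAt k M ∧ LcAt (k + 1) N
  | k, sharp _ A => LcAt k A
  | k, sharpIntro _ M => LcAt k M
  | k, sharpElim _ N => LcAt k N

lemma LcAt.succ {t : Tm F K} : ∀ {k : ℕ}, LcAt k t → LcAt (k + 1) t := by
  induction t <;> intro k h <;> simp only [LcAt] at h ⊢ <;> grind

lemma LcAt.mono {t : Tm F K} {k l : ℕ} (h : LcAt k t) (hkl : k ≤ l) : LcAt l t := by
  induction hkl with
  | refl => exact h
  | step _ ih => exact ih.succ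

lemma LcAt.openAt_eq {t : Tm F K} (s : Tm F K) : ∀ {k : ℕ}, LcAt k t → openAt s k t = t := by
  induction t <;> intro k h <;> simp only [LcAt] at h <;> simp only [openAt] <;> grind

/-- No condition on `s` is needed: opening replaces the index `k` only. -/
lemma LcAt.of_openAt {s t : Tm F K} : ∀ {k : ℕ}, LcAt k (openAt s k t) → LcAt (k + 1) t := by
  induction t with
  | bvar n =>
    intro k h
    by_cases hn : n = k
    · simp [LcAt, hn]
    · simp only [openAt, if_neg hn, LcAt] at h ⊢
      omega
  | _ => intro k h; simp only [openAt, LcAt] at h ⊢ <;> grind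

lemma LcAt.openAt {s t : Tm F K} (hs : LcAt 0 s) :
    ∀ {k : ℕ}, LcAt (k + 1) t → LcAt k (openAt s k t) := by
  induction t with
  | bvar n =>
    intro k h
    by_cases hn : n = k
    · simpa [Tm.openAt, hn] using hs.mono (Nat.zero_le _)
    · simp only [Tm.openAt, if_neg hn, LcAt] at h ⊢
      omega
  | _ => intro k h; simp only [Tm.openAt, LcAt] at h ⊢ <;> grind

lemma LcAt.open1 {s t : Tm F K} (ht : LcAt 1 t) (hs : LcAt 0 s) : LcAt 0 (open1 t s) :=
  LcAt.openAt hs ht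

lemma LcAt.open2 {s₁ s₂ t : Tm F K} (ht : LcAt 2 t) (h₁ : LcAt 0 s₁) (h₂ : LcAt 0 s₂) :
    LcAt 0 (open2 t s₁ s₂) :=
  LcAt.openAt h₂ (LcAt.openAt h₁ ht)

lemma LcAt.open3 {s₁ s₂ s₃ t : Tm F K} (ht : LcAt 3 t) (h₁ : LcAt 0 s₁) (h₂ : LcAt 0 s₂)
    (h₃ : LcAt 0 s₃) : LcAt 0 (open3 t s₁ s₂ s₃) :=
  LcAt.openAt h₃ (LcAt.openAt h₂ (LcAt.openAt h₁ ht))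

lemma forall_lcAt_open1_iff {t : Tm F K} {L : Finset ℕ} :
    (∀ x ∉ L, LcAt 0 (open1 t (fvar x))) ↔ LcAt 1 t := by
  refine ⟨fun h => ?_, fun h x _ => h.open1 trivial⟩
  obtain ⟨x, hx⟩ := Infinite.exists_notMem_finset L
  exact (h x hx).of_openAt

lemma forall_lcAt_open2_iff {t : Tm F K} {L : Finset ℕ} :
    (∀ x ∉ L, ∀ y ∉ L, x ≠ y → LcAt 0 (open2 t (fvar x) (fvar y))) ↔ LcAt 2 t := by
  refine ⟨fun h => ?_, fun h x _ y _ _ => h.open2 trivial trivial⟩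
  obtain ⟨x, hx⟩ := Infinite.exists_notMem_finset L
  obtain ⟨y, hy⟩ := Infinite.exists_notMem_finset (insert x L)
  rw [Finset.mem_insert, not_or] at hy
  exact (h x hx y hy.2 (Ne.symm hy.1)).of_openAt.of_openAt

lemma forall_lcAt_open3_iff {t : Tm F K} {L : Finset ℕ} :
    (∀ x ∉ L, ∀ y ∉ L, ∀ q ∉ L, x ≠ y → x ≠ q → y ≠ q →
      LcAt 0 (open3 t (fvar x) (fvar y) (fvar q))) ↔ LcAt 3 t := by
  refine ⟨fun h => ?_, fun h x _ y _ q _ _ _ _ => h.open3 trivial trivial trivial⟩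
  obtain ⟨x, hx⟩ := Infinite.exists_notMem_finset L
  obtain ⟨y, hy⟩ := Infinite.exists_notMem_finset (insert x L)
  obtain ⟨q, hq⟩ := Infinite.exists_notMem_finset (insert x (insert y L))
  simp only [Finset.mem_insert, not_or] at hy hq
  exact (h x hx y hy.2 q hq.2.2 (Ne.symm hy.1) (Ne.symm hq.1)
    (Ne.symm hq.2.1)).of_openAt.of_openAt.of_openAt

end Tm

namespace Judgment

variable {F : Type u} {K : Type v}

/-- All terms of a judgement, except those in the contexts of typing and equality judgements, are
locally closed. -/
def Lc : Judgment F K → Prop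
  | ctx Γ => ∀ e ∈ Γ, e.ty.LcAt 0
  | tm _ a A => a.LcAt 0 ∧ A.LcAt 0
  | eq _ a b A => a.LcAt 0 ∧ b.LcAt 0 ∧ A.LcAt 0

/-- The context of a judgement. -/
def cxt : Judgment F K → Cxt F K
  | ctx Γ => Γ
  | tm Γ _ _ => Γ
  | eq Γ _ _ _ => Γ

/-- The same judgement in another context. -/
def withCxt : Judgment F K → Cxt F K → Judgment F K
  | ctx _, Δ => ctx Δ
  | tm _ a A, Δ => tm Δ a A
  | eq _ a b A, Δ => eq Δ a b A

end Judgment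

section Lc

variable {F : Type u} [SemilatticeInf F] [OrderTop F] {K : Type v} {S : Signature F K}

/-- Types have to be tracked along with terms: the `η`-expansion of `f : pi A B` contains `A`, which
is only known to be locally closed because it occurs in the type of `f`. -/
lemma Derivable.lc {J : Judgment F K} (h : Derivable S J) : J.Lc := by
  induction h with
  | var _ hx ih => exact ⟨trivial, ih _ hx⟩
  | _ =>
    simp_all only [Judgment.Lc, Tm.LcAt, Tm.LcAt.open1, Tm.LcAt.open2, Tm.LcAt.open3,
      Tm.LcAt.succ, Tm.forall_lcAt_open1_iff, Tm.forall_lcAt_open2_iff, Tm.forall_lcAt_open3_iff,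
      forall_and, and_true, true_and, zero_add, Nat.zero_lt_one, List.forall_mem_cons,
      List.not_mem_nil, and_self, false_implies, implies_true] <;>
    grind [Tm.LcAt, Tm.LcAt.open1, Tm.LcAt.open2, Tm.LcAt.open3]

end Lc

/-! ### Weakening and change of focuses -/

namespace Cxt

/-- The set of the names declared in the context. -/
def dom {F : Type u} {K : Type v} (Γ : Cxt F K) : Finset ℕ := Γ.names.toFinset

lemma notMem_names {F : Type u} {K : Type v} {Γ : Cxt F K} {x : ℕ} (h : x ∉ Γ.dom) :
    x ∉ Γ.names := by
  simpa [dom] using h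

variable {F : Type u} [SemilatticeInf F] {K : Type v} {Γ Δ : Cxt F K} {φ ψ : F}

/-- Every variable of `Γ` is declared in `Δ` with the same type and an equal or smaller
focus.  Judgements can be transported along this relation: it comprises ordinary weakening,
the passage from `φ \ Γ` to `Γ`, and the passage from `Γ` to `φ Γ`. -/
def Sub (Γ Δ : Cxt F K) : Prop :=
  ∀ x χ A, (⟨x, χ, A⟩ : Entry F K) ∈ Γ → ∃ χ' ≤ χ, (⟨x, χ', A⟩ : Entry F K) ∈ Δ

lemma mem_divide {e : Entry F K} : e ∈ Γ.divide φ ↔ e ∈ Γ ∧ e.focus ≤ φ := by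
  simp [divide]

lemma mem_promote {x : ℕ} {χ : F} {A : Tm F K} :
    (⟨x, χ, A⟩ : Entry F K) ∈ Γ.promote φ ↔
      ∃ χ', (⟨x, χ', A⟩ : Entry F K) ∈ Γ ∧ φ ⊓ χ' = χ := by
  simp only [promote, List.mem_map, Entry.mk.injEq]
  constructor
  · rintro ⟨⟨x, χ', A⟩, h, rfl, rfl, rfl⟩
    exact ⟨χ', h, rfl⟩
  · rintro ⟨χ', h, rfl⟩
    exact ⟨_, h, rfl, rfl, rfl⟩

lemma divide_divide : (Γ.divide φ).divide ψ = Γ.divide (φ ⊓ ψ) := by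
  simp only [divide, List.filter_filter]
  refine List.filter_congr fun e _ => ?_
  rw [Bool.eq_iff_iff]
  simp [and_comm]

lemma divide_top [OrderTop F] : Γ.divide ⊤ = Γ := by
  simp [divide]

lemma promote_promote : (Γ.promote φ).promote ψ = Γ.promote (φ ⊓ ψ) := by
  simp [promote, Function.comp_def, ← inf_assoc, inf_comm ψ φ]

lemma divide_promote_of_le (h : φ ≤ ψ) : (Γ.promote φ).divide ψ = Γ.promote φ := by
  simp only [divide, promote, List.filter_eq_self, List.mem_map, decide_eq_true_eq]
  rintro _ ⟨e, _, rfl⟩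
  exact inf_le_left.trans h

lemma divide_cons_of_le {x : ℕ} {χ : F} {A : Tm F K} (h : χ ≤ φ) :
    Cxt.divide φ (⟨x, χ, A⟩ :: Γ) = ⟨x, χ, A⟩ :: Γ.divide φ := by
  simp [divide, h]

lemma names_promote : (Γ.promote φ).names = Γ.names := by
  simp [names, promote, Function.comp_def]

lemma notMem_names_divide {x : ℕ} (h : x ∉ Γ.names) : x ∉ (Γ.divide φ).names := by
  simp only [names, List.mem_map, mem_divide] at h ⊢
  grind

namespace Sub

lemma refl (Γ : Cxt F K) : Sub Γ Γ := fun _ χ _ h => ⟨χ, le_rfl, h⟩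

lemma trans {Θ : Cxt F K} (h : Sub Γ Δ) (h' : Sub Δ Θ) : Sub Γ Θ := fun x χ A hx =>
  let ⟨χ', hχ, hm⟩ := h x χ A hx
  let ⟨χ'', hχ', hm'⟩ := h' x χ' A hm
  ⟨χ'', hχ'.trans hχ, hm'⟩

lemma weak (h : Sub Γ Δ) {e : Entry F K} : Sub Γ (e :: Δ) := fun x χ A hx =>
  let ⟨χ', hχ, hm⟩ := h x χ A hx
  ⟨χ', hχ, List.mem_cons_of_mem _ hm⟩

lemma cons (h : Sub Γ Δ) {e : Entry F K} : Sub (e :: Γ) (e :: Δ) := by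
  intro x χ A hx
  rcases List.mem_cons.1 hx with rfl | hx
  · exact ⟨χ, le_rfl, List.mem_cons_self⟩
  · exact h.weak x χ A hx

lemma divide (h : Sub Γ Δ) (φ : F) : Sub (Γ.divide φ) (Δ.divide φ) := by
  intro x χ A hx
  obtain ⟨hx, hφ⟩ := mem_divide.1 hx
  obtain ⟨χ', hχ, hm⟩ := h x χ A hx
  exact ⟨χ', hχ, mem_divide.2 ⟨hm, hχ.trans hφ⟩⟩

lemma promote (h : Sub Γ Δ) (φ : F) : Sub (Γ.promote φ) (Δ.promote φ) := by
  intro x χ A hx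
  obtain ⟨χ', hx', rfl⟩ := mem_promote.1 hx
  obtain ⟨θ, hθ, hm⟩ := h x χ' A hx'
  exact ⟨φ ⊓ θ, inf_le_inf_left _ hθ, mem_promote.2 ⟨θ, hm, rfl⟩⟩

lemma promote_right (Γ : Cxt F K) (φ : F) : Sub Γ (Γ.promote φ) := fun _ χ _ hx =>
  ⟨φ ⊓ χ, inf_le_right, mem_promote.2 ⟨χ, hx, rfl⟩⟩

lemma divide_promote (Γ : Cxt F K) (φ χ : F) :
    Sub (Γ.divide χ) ((Γ.promote φ).divide (φ ⊓ χ)) := by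
  intro x θ A hx
  obtain ⟨hx, hθ⟩ := mem_divide.1 hx
  exact ⟨φ ⊓ θ, inf_le_right,
    mem_divide.2 ⟨mem_promote.2 ⟨θ, hx, rfl⟩, inf_le_inf_left _ hθ⟩⟩

end Sub

/-- `Refocus Γ Δ`: the context `Δ` arises from `Γ` by finitely many operations `φ Γ`, `φ \ Γ`. -/
inductive Refocus (Γ : Cxt F K) : Cxt F K → Prop
  | refl : Refocus Γ Γ
  | promote {Δ : Cxt F K} (φ : F) : Refocus Γ Δ → Refocus Γ (Δ.promote φ)
  | divide {Δ : Cxt F K} (φ : F) : Refocus Γ Δ → Refocus Γ (Δ.divide φ)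

lemma Refocus.trans {Θ : Cxt F K} (h : Refocus Γ Δ) (h' : Refocus Δ Θ) : Refocus Γ Θ := by
  induction h' with
  | refl => exact h
  | promote φ _ ih => exact ih.promote φ
  | divide φ _ ih => exact ih.divide φ

lemma Refocus.notMem_names {x : ℕ} (h : Refocus Γ Δ) (hx : x ∉ Γ.names) : x ∉ Δ.names := by
  induction h with
  | refl => exact hx
  | promote φ _ ih => rwa [names_promote]
  | divide φ _ ih => exact notMem_names_divide ih

/-- A declaration at the end of a context either disappears under refocusing, or it acquires a
focus `χ'` for which the `χ'`-crisp part of the new context contains the original `χ`-crisp part;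
so its type remains meaningful. -/
lemma Refocus.of_cons {x : ℕ} {χ : F} {A : Tm F K} (h : Refocus (⟨x, χ, A⟩ :: Γ) Δ) :
    Refocus Γ Δ ∨ ∃ (χ' : F) (Δ' : Cxt F K), Δ = ⟨x, χ', A⟩ :: Δ' ∧ Refocus Γ Δ' ∧
      Sub (Γ.divide χ) (Δ'.divide χ') := by
  induction h with
  | refl => exact .inr ⟨χ, Γ, rfl, .refl, .refl _⟩
  | promote φ _ ih =>
    rcases ih with h | ⟨χ', Δ', rfl, h, hs⟩
    · exact .inl (h.promote φ)
    · exact .inr ⟨φ ⊓ χ', Δ'.promote φ, rfl, h.promote φ, hs.trans (.divide_promote Δ' φ χ')⟩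
  | divide φ _ ih =>
    rcases ih with h | ⟨χ', Δ', rfl, h, hs⟩
    · exact .inl (h.divide φ)
    · by_cases hχ : χ' ≤ φ
      · refine .inr ⟨χ', Δ'.divide φ, divide_cons_of_le hχ, h.divide φ, ?_⟩
        rwa [divide_divide, inf_eq_right.2 hχ]
      · left
        have : Cxt.divide φ (⟨x, χ', A⟩ :: Δ') = Δ'.divide φ := by simp [Cxt.divide, hχ]
        rw [this]
        exact h.divide φ

/-- All contexts that arise from `Γ` by refocusing are well-formed.  This holds for every
well-formed context, but the proof uses the transport of judgements, which in turn is proved for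
target contexts of this kind. -/
def Stable [OrderTop F] (S : Signature F K) (Γ : Cxt F K) : Prop :=
  ∀ Δ, Refocus Γ Δ → Derivable S (.ctx Δ)

namespace Stable

variable [OrderTop F] {S : Signature F K}

lemma ctx (h : Γ.Stable S) : Derivable S (.ctx Γ) := h Γ .refl

lemma refocus (h : Γ.Stable S) (hΔ : Refocus Γ Δ) : Δ.Stable S := fun _ h' => h _ (hΔ.trans h')

lemma promote (h : Γ.Stable S) (φ : F) : (Γ.promote φ).Stable S := h.refocus (.promote φ .refl)

lemma divide (h : Γ.Stable S) (φ : F) : (Γ.divide φ).Stable S := h.refocus (.divide φ .refl)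

end Stable

end Cxt

/-- The judgement `J` can be transported to every stable context `Δ` with `J.cxt.Sub Δ`. -/
def Judgment.Weakens {F : Type u} [SemilatticeInf F] [OrderTop F] {K : Type v}
    (S : Signature F K) (J : Judgment F K) : Prop :=
  ∀ Δ : Cxt F K, Δ.Stable S → J.cxt.Sub Δ → Derivable S (J.withCxt Δ)

namespace Derivable

variable {F : Type u} [SemilatticeInf F] [OrderTop F] {K : Type v} {S : Signature F K}
  {Γ Δ : Cxt F K} {φ ψ χ : F} {A B : Tm F K} {i j : ℕ}

/-- Stability of an extended context needs transport of the new type only, which inside the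
induction for `Derivable.weakens` is an induction hypothesis. -/
lemma stable_cons (hΔ : Δ.Stable S) (h : Γ.Sub Δ)
    (hA : (Judgment.tm (Γ.divide χ) A (.univ i)).Weakens S) {x : ℕ} (hx : x ∉ Δ.names) :
    Cxt.Stable S (⟨x, χ, A⟩ :: Δ) := by
  intro Θ hΘ
  rcases hΘ.of_cons with hr | ⟨χ', Δ', rfl, hr, hs⟩
  · exact hΔ _ hr
  · exact .ctx_ext (hΔ _ hr)
      (hA _ ((hΔ.refocus hr).divide χ') ((h.divide χ).trans hs)) (hr.notMem_names hx)

lemma stable_cons_top (hΔ : Δ.Stable S) (h : Γ.Sub Δ)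
    (hA : (Judgment.tm Γ A (.univ i)).Weakens S) {x : ℕ} (hx : x ∉ Δ.names) :
    Cxt.Stable S (⟨x, ⊤, A⟩ :: Δ) :=
  stable_cons hΔ h (by rwa [Cxt.divide_top]) hx

/-- Transport of a family of judgements below one bound variable. -/
lemma weaken_under {J : ℕ → Judgment F K} {L : Finset ℕ}
    (ih : ∀ x ∉ L, (J x).Weakens S) (hJ : ∀ x, (J x).cxt = ⟨x, χ, A⟩ :: Γ)
    (hA : (Judgment.tm (Γ.divide χ) A (.univ i)).Weakens S)
    (hΔ : Δ.Stable S) (h : Γ.Sub Δ) :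
    ∀ x ∉ L ∪ Δ.dom, Derivable S ((J x).withCxt (⟨x, χ, A⟩ :: Δ)) := by
  intro x hx
  rw [Finset.notMem_union] at hx
  exact ih x hx.1 _ (stable_cons hΔ h hA (Cxt.notMem_names hx.2)) (by rw [hJ]; exact h.cons)

lemma weaken_under_top {J : ℕ → Judgment F K} {L : Finset ℕ}
    (ih : ∀ x ∉ L, (J x).Weakens S) (hJ : ∀ x, (J x).cxt = ⟨x, ⊤, A⟩ :: Γ)
    (hA : (Judgment.tm Γ A (.univ i)).Weakens S) (hΔ : Δ.Stable S) (h : Γ.Sub Δ) :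
    ∀ x ∉ L ∪ Δ.dom, Derivable S ((J x).withCxt (⟨x, ⊤, A⟩ :: Δ)) :=
  weaken_under ih hJ (by rwa [Cxt.divide_top]) hΔ h

/-- Transport of a family of judgements below two bound variables. -/
lemma weaken_under_two {J : ℕ → ℕ → Judgment F K} {B : ℕ → Tm F K} {L : Finset ℕ}
    (ih : ∀ x ∉ L, ∀ y ∉ L, x ≠ y → (J x y).Weakens S)
    (hJ : ∀ x y, (J x y).cxt = ⟨y, ⊤, B x⟩ :: ⟨x, ⊤, A⟩ :: Γ)
    (hA : (Judgment.tm Γ A (.univ i)).Weakens S)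
    (hB : ∀ x ∉ L, (Judgment.tm (⟨x, ⊤, A⟩ :: Γ) (B x) (.univ j)).Weakens S)
    (hΔ : Δ.Stable S) (h : Γ.Sub Δ) :
    ∀ x ∉ L ∪ Δ.dom, ∀ y ∉ L ∪ Δ.dom, x ≠ y →
      Derivable S ((J x y).withCxt (⟨y, ⊤, B x⟩ :: ⟨x, ⊤, A⟩ :: Δ)) := by
  intro x hx y hy hxy
  rw [Finset.notMem_union] at hx hy
  have h1 := stable_cons_top hΔ h hA (Cxt.notMem_names hx.2)
  refine ih x hx.1 y hy.1 hxy _ (stable_cons_top h1 h.cons (hB x hx.1) ?_)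
    (by rw [hJ]; exact h.cons.cons)
  simpa [Cxt.names, hxy.symm] using Cxt.notMem_names hy.2

/-- Transport of a family of judgements below the three variables bound in the motive of
path induction. -/
lemma weaken_under_id {J : ℕ → ℕ → ℕ → Judgment F K} {L : Finset ℕ}
    (ih : ∀ x ∉ L, ∀ y ∉ L, ∀ q ∉ L, x ≠ y → x ≠ q → y ≠ q → (J x y q).Weakens S)
    (hJ : ∀ x y q, (J x y q).cxt =
      ⟨q, ⊤, .idt A (.fvar x) (.fvar y)⟩ :: ⟨y, ⊤, A⟩ :: ⟨x, ⊤, A⟩ :: Γ)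
    (hA : (Judgment.tm Γ A (.univ i)).Weakens S) (hΔ : Δ.Stable S) (h : Γ.Sub Δ) :
    ∀ x ∉ L ∪ Δ.dom, ∀ y ∉ L ∪ Δ.dom, ∀ q ∉ L ∪ Δ.dom, x ≠ y → x ≠ q → y ≠ q →
      Derivable S ((J x y q).withCxt
        (⟨q, ⊤, .idt A (.fvar x) (.fvar y)⟩ :: ⟨y, ⊤, A⟩ :: ⟨x, ⊤, A⟩ :: Δ)) := by
  intro x hx y hy q hq hxy hxq hyq
  rw [Finset.notMem_union] at hx hy hq
  have h1 := stable_cons_top hΔ h hA (Cxt.notMem_names hx.2)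
  have h2 := stable_cons_top h1 h.weak hA (x := y)
    (by simpa [Cxt.names, hxy.symm] using Cxt.notMem_names hy.2)
  have hid : (Judgment.tm (⟨y, ⊤, A⟩ :: ⟨x, ⊤, A⟩ :: Γ) (.idt A (.fvar x) (.fvar y))
      (.univ i)).Weakens S := by
    intro Θ hΘ hs
    have hx' : (⟨x, ⊤, A⟩ : Entry F K) ∈ (⟨y, ⊤, A⟩ :: ⟨x, ⊤, A⟩ :: Γ : Cxt F K) := by simp
    obtain ⟨_, _, hy''⟩ := hs y ⊤ A List.mem_cons_self
    obtain ⟨_, _, hx''⟩ := hs x ⊤ A hx'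
    exact .id_form (hA Θ hΘ ((Cxt.Sub.refl Γ).weak.weak.trans hs))
      (.var hΘ.ctx hx'') (.var hΘ.ctx hy'')
  have h3 := stable_cons_top h2 h.cons.cons hid (x := q)
    (by simpa [Cxt.names, hxq.symm, hyq.symm] using Cxt.notMem_names hq.2)
  exact ih x hx.1 y hy.1 q hq.1 hxy hxq hyq _ h3 (by rw [hJ]; exact h.cons.cons.cons)

end Derivable

namespace Derivable

variable {F : Type u} [SemilatticeInf F] [OrderTop F] {K : Type v} {S : Signature F K}
  {Γ Δ : Cxt F K} {φ ψ χ : F} {A B : Tm F K} {i j : ℕ}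

/-- Transport into stable contexts.  Wherever a rule binds variables, their types are known to be
types by further premises of the rule, so the extended target context is again stable. -/
lemma weakens {J : Judgment F K} (hJ : Derivable S J) : J.Weakens S := by
  induction hJ with
  | ctx_empty => exact fun Δ hΔ _ => hΔ.ctx
  | ctx_ext => exact fun Δ hΔ _ => hΔ.ctx
  | var _ hx =>
    intro Δ hΔ h
    obtain ⟨χ, _, hm⟩ := h _ _ _ hx
    exact .var hΔ.ctx hm
  | eq_refl _ ih => exact fun Δ hΔ h => .eq_refl (ih Δ hΔ h)
  | eq_symm _ ih => exact fun Δ hΔ h => .eq_symm (ih Δ hΔ h)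
  | eq_trans _ _ ih ih' => exact fun Δ hΔ h => .eq_trans (ih Δ hΔ h) (ih' Δ hΔ h)
  | conv _ _ ih ih' => exact fun Δ hΔ h => .conv (ih Δ hΔ h) (ih' Δ hΔ h)
  | conv_eq _ _ ih ih' => exact fun Δ hΔ h => .conv_eq (ih Δ hΔ h) (ih' Δ hΔ h)
  | con _ hc => exact fun Δ hΔ h => .con hΔ.ctx hc
  | con_eq _ he ha hb => exact fun Δ hΔ h => .con_eq hΔ.ctx he ha hb
  | univ => exact fun Δ hΔ h => .univ hΔ.ctx
  | cumul _ ih => exact fun Δ hΔ h => .cumul (ih Δ hΔ h)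
  | cumul_eq _ ih => exact fun Δ hΔ h => .cumul_eq (ih Δ hΔ h)
  | pi_form L _ _ ihA ihB =>
    exact fun Δ hΔ h => .pi_form (L ∪ Δ.dom) (ihA Δ hΔ h)
      (weaken_under_top ihB (fun _ => rfl) ihA hΔ h)
  | pi_intro L _ _ ihA ihb =>
    exact fun Δ hΔ h => .pi_intro (L ∪ Δ.dom) (ihA Δ hΔ h)
      (weaken_under_top ihb (fun _ => rfl) ihA hΔ h)
  | pi_elim _ _ ihf iha => exact fun Δ hΔ h => .pi_elim (ihf Δ hΔ h) (iha Δ hΔ h)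
  | pi_beta L _ _ _ ihA ihb iha =>
    exact fun Δ hΔ h => .pi_beta (L ∪ Δ.dom) (ihA Δ hΔ h)
      (weaken_under_top ihb (fun _ => rfl) ihA hΔ h) (iha Δ hΔ h)
  | pi_eta _ ihf => exact fun Δ hΔ h => .pi_eta (ihf Δ hΔ h)
  | pi_form_cong L _ _ _ ihA ihA' ihB =>
    exact fun Δ hΔ h => .pi_form_cong (L ∪ Δ.dom) (ihA Δ hΔ h) (ihA' Δ hΔ h)
      (weaken_under_top ihB (fun _ => rfl) ihA hΔ h)
  | pi_intro_cong L _ _ _ ihA ihA' ihb =>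
    exact fun Δ hΔ h => .pi_intro_cong (L ∪ Δ.dom) (ihA Δ hΔ h) (ihA' Δ hΔ h)
      (weaken_under_top ihb (fun _ => rfl) ihA hΔ h)
  | pi_elim_cong _ _ ihf iha => exact fun Δ hΔ h => .pi_elim_cong (ihf Δ hΔ h) (iha Δ hΔ h)
  | sigma_form L _ _ ihA ihB =>
    exact fun Δ hΔ h => .sigma_form (L ∪ Δ.dom) (ihA Δ hΔ h)
      (weaken_under_top ihB (fun _ => rfl) ihA hΔ h)
  | sigma_intro L _ _ _ _ ihA ihB iha ihb =>
    exact fun Δ hΔ h => .sigma_intro (L ∪ Δ.dom) (ihA Δ hΔ h)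
      (weaken_under_top ihB (fun _ => rfl) ihA hΔ h) (iha Δ hΔ h) (ihb Δ hΔ h)
  | sigma_elim L _ _ _ _ _ ihA ihB ihC ihg ihp =>
    intro Δ hΔ h
    have hσ : (Judgment.tm _ (.sigma _ _) (.univ _)).Weakens S := fun Θ hΘ h =>
      .sigma_form (_ ∪ Θ.dom) (ihA Θ hΘ h) (weaken_under_top ihB (fun _ => rfl) ihA hΘ h)
    exact .sigma_elim (L ∪ Δ.dom) (ihA Δ hΔ h) (weaken_under_top ihB (fun _ => rfl) ihA hΔ h)
      (weaken_under_top ihC (fun _ => rfl) hσ hΔ h)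
      (weaken_under_two ihg (fun _ _ => rfl) ihA ihB hΔ h) (ihp Δ hΔ h)
  | sigma_beta L _ _ _ _ _ _ ihA ihB ihC ihg iha ihb =>
    intro Δ hΔ h
    have hσ : (Judgment.tm _ (.sigma _ _) (.univ _)).Weakens S := fun Θ hΘ h =>
      .sigma_form (_ ∪ Θ.dom) (ihA Θ hΘ h) (weaken_under_top ihB (fun _ => rfl) ihA hΘ h)
    exact .sigma_beta (L ∪ Δ.dom) (ihA Δ hΔ h) (weaken_under_top ihB (fun _ => rfl) ihA hΔ h)
      (weaken_under_top ihC (fun _ => rfl) hσ hΔ h)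
      (weaken_under_two ihg (fun _ _ => rfl) ihA ihB hΔ h) (iha Δ hΔ h) (ihb Δ hΔ h)
  | sigma_form_cong L _ _ _ ihA ihA' ihB =>
    exact fun Δ hΔ h => .sigma_form_cong (L ∪ Δ.dom) (ihA Δ hΔ h) (ihA' Δ hΔ h)
      (weaken_under_top ihB (fun _ => rfl) ihA hΔ h)
  | sigma_intro_cong L _ _ _ _ ihA ihB iha ihb =>
    exact fun Δ hΔ h => .sigma_intro_cong (L ∪ Δ.dom) (ihA Δ hΔ h)
      (weaken_under_top ihB (fun _ => rfl) ihA hΔ h) (iha Δ hΔ h) (ihb Δ hΔ h)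
  | sigma_elim_cong L _ _ _ _ _ ihA ihB ihC ihg ihp =>
    intro Δ hΔ h
    have hσ : (Judgment.tm _ (.sigma _ _) (.univ _)).Weakens S := fun Θ hΘ h =>
      .sigma_form (_ ∪ Θ.dom) (ihA Θ hΘ h) (weaken_under_top ihB (fun _ => rfl) ihA hΘ h)
    exact .sigma_elim_cong (L ∪ Δ.dom) (ihA Δ hΔ h) (weaken_under_top ihB (fun _ => rfl) ihA hΔ h)
      (weaken_under_top ihC (fun _ => rfl) hσ hΔ h)
      (weaken_under_two ihg (fun _ _ => rfl) ihA ihB hΔ h) (ihp Δ hΔ h)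
  | sum_form _ _ ihA ihB => exact fun Δ hΔ h => .sum_form (ihA Δ hΔ h) (ihB Δ hΔ h)
  | sum_inl _ _ _ ihA ihB iha =>
    exact fun Δ hΔ h => .sum_inl (ihA Δ hΔ h) (ihB Δ hΔ h) (iha Δ hΔ h)
  | sum_inr _ _ _ ihA ihB ihb =>
    exact fun Δ hΔ h => .sum_inr (ihA Δ hΔ h) (ihB Δ hΔ h) (ihb Δ hΔ h)
  | sum_elim L _ _ _ _ _ _ ihA ihB ihC ihl ihr ihp =>
    intro Δ hΔ h
    have hs : (Judgment.tm _ (.sum _ _) (.univ _)).Weakens S := fun Θ hΘ h =>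
      .sum_form (ihA Θ hΘ h) (ihB Θ hΘ h)
    exact .sum_elim (L ∪ Δ.dom) (ihA Δ hΔ h) (ihB Δ hΔ h)
      (weaken_under_top ihC (fun _ => rfl) hs hΔ h)
      (weaken_under_top ihl (fun _ => rfl) ihA hΔ h)
      (weaken_under_top ihr (fun _ => rfl) ihB hΔ h) (ihp Δ hΔ h)
  | sum_beta_inl L _ _ _ _ _ _ ihA ihB ihC ihl ihr ihp =>
    intro Δ hΔ h
    have hs : (Judgment.tm _ (.sum _ _) (.univ _)).Weakens S := fun Θ hΘ h =>
      .sum_form (ihA Θ hΘ h) (ihB Θ hΘ h)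
    exact .sum_beta_inl (L ∪ Δ.dom) (ihA Δ hΔ h) (ihB Δ hΔ h)
      (weaken_under_top ihC (fun _ => rfl) hs hΔ h)
      (weaken_under_top ihl (fun _ => rfl) ihA hΔ h)
      (weaken_under_top ihr (fun _ => rfl) ihB hΔ h) (ihp Δ hΔ h)
  | sum_beta_inr L _ _ _ _ _ _ ihA ihB ihC ihl ihr ihp =>
    intro Δ hΔ h
    have hs : (Judgment.tm _ (.sum _ _) (.univ _)).Weakens S := fun Θ hΘ h =>
      .sum_form (ihA Θ hΘ h) (ihB Θ hΘ h)
    exact .sum_beta_inr (L ∪ Δ.dom) (ihA Δ hΔ h) (ihB Δ hΔ h)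
      (weaken_under_top ihC (fun _ => rfl) hs hΔ h)
      (weaken_under_top ihl (fun _ => rfl) ihA hΔ h)
      (weaken_under_top ihr (fun _ => rfl) ihB hΔ h) (ihp Δ hΔ h)
  | sum_form_cong _ _ ihA ihB => exact fun Δ hΔ h => .sum_form_cong (ihA Δ hΔ h) (ihB Δ hΔ h)
  | sum_inl_cong _ _ _ ihA ihB iha =>
    exact fun Δ hΔ h => .sum_inl_cong (ihA Δ hΔ h) (ihB Δ hΔ h) (iha Δ hΔ h)
  | sum_inr_cong _ _ _ ihA ihB ihb =>
    exact fun Δ hΔ h => .sum_inr_cong (ihA Δ hΔ h) (ihB Δ hΔ h) (ihb Δ hΔ h)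
  | sum_elim_cong L _ _ _ _ _ _ ihA ihB ihC ihl ihr ihp =>
    intro Δ hΔ h
    have hs : (Judgment.tm _ (.sum _ _) (.univ _)).Weakens S := fun Θ hΘ h =>
      .sum_form (ihA Θ hΘ h) (ihB Θ hΘ h)
    exact .sum_elim_cong (L ∪ Δ.dom) (ihA Δ hΔ h) (ihB Δ hΔ h)
      (weaken_under_top ihC (fun _ => rfl) hs hΔ h)
      (weaken_under_top ihl (fun _ => rfl) ihA hΔ h)
      (weaken_under_top ihr (fun _ => rfl) ihB hΔ h) (ihp Δ hΔ h)
  | empty_form => exact fun Δ hΔ h => .empty_form hΔ.ctx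
  | empty_elim L _ _ ihC ihp =>
    exact fun Δ hΔ h => .empty_elim (L ∪ Δ.dom)
      (weaken_under_top ihC (fun _ => rfl)
        (fun Θ hΘ _ => .empty_form (i := 0) hΘ.ctx) hΔ h) (ihp Δ hΔ h)
  | empty_elim_cong L _ _ ihC ihp =>
    exact fun Δ hΔ h => .empty_elim_cong (L ∪ Δ.dom)
      (weaken_under_top ihC (fun _ => rfl)
        (fun Θ hΘ _ => .empty_form (i := 0) hΘ.ctx) hΔ h) (ihp Δ hΔ h)
  | unit_form => exact fun Δ hΔ h => .unit_form hΔ.ctx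
  | unit_intro => exact fun Δ hΔ h => .unit_intro hΔ.ctx
  | unit_elim L _ _ _ ihC ihc ihp =>
    exact fun Δ hΔ h => .unit_elim (L ∪ Δ.dom)
      (weaken_under_top ihC (fun _ => rfl)
        (fun Θ hΘ _ => .unit_form (i := 0) hΘ.ctx) hΔ h)
      (ihc Δ hΔ h) (ihp Δ hΔ h)
  | unit_beta L _ _ ihC ihc =>
    exact fun Δ hΔ h => .unit_beta (L ∪ Δ.dom)
      (weaken_under_top ihC (fun _ => rfl)
        (fun Θ hΘ _ => .unit_form (i := 0) hΘ.ctx) hΔ h) (ihc Δ hΔ h)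
  | unit_elim_cong L _ _ _ ihC ihc ihp =>
    exact fun Δ hΔ h => .unit_elim_cong (L ∪ Δ.dom)
      (weaken_under_top ihC (fun _ => rfl)
        (fun Θ hΘ _ => .unit_form (i := 0) hΘ.ctx) hΔ h)
      (ihc Δ hΔ h) (ihp Δ hΔ h)
  | nat_form => exact fun Δ hΔ h => .nat_form hΔ.ctx
  | nat_zero => exact fun Δ hΔ h => .nat_zero hΔ.ctx
  | nat_succ _ ih => exact fun Δ hΔ h => .nat_succ (ih Δ hΔ h)
  | nat_elim L _ _ _ _ ihC ihz ihs ihn =>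
    intro Δ hΔ h
    have hN (Θ : Cxt F K) : (Judgment.tm Θ .nat (.univ 0)).Weakens S := fun _ hΔ _ =>
      .nat_form hΔ.ctx
    have hC := weaken_under_top ihC (fun _ => rfl) (hN _) hΔ h
    exact .nat_elim (L ∪ Δ.dom) hC (ihz Δ hΔ h)
      (weaken_under_two ihs (fun _ _ => rfl) (hN _) ihC hΔ h) (ihn Δ hΔ h)
  | nat_beta_zero L _ _ _ ihC ihz ihs =>
    intro Δ hΔ h
    have hN (Θ : Cxt F K) : (Judgment.tm Θ .nat (.univ 0)).Weakens S := fun _ hΔ _ =>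
      .nat_form hΔ.ctx
    have hC := weaken_under_top ihC (fun _ => rfl) (hN _) hΔ h
    exact .nat_beta_zero (L ∪ Δ.dom) hC (ihz Δ hΔ h)
      (weaken_under_two ihs (fun _ _ => rfl) (hN _) ihC hΔ h)
  | nat_beta_succ L _ _ _ _ ihC ihz ihs ihn =>
    intro Δ hΔ h
    have hN (Θ : Cxt F K) : (Judgment.tm Θ .nat (.univ 0)).Weakens S := fun _ hΔ _ =>
      .nat_form hΔ.ctx
    have hC := weaken_under_top ihC (fun _ => rfl) (hN _) hΔ h
    exact .nat_beta_succ (L ∪ Δ.dom) hC (ihz Δ hΔ h)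
      (weaken_under_two ihs (fun _ _ => rfl) (hN _) ihC hΔ h) (ihn Δ hΔ h)
  | nat_succ_cong _ ih => exact fun Δ hΔ h => .nat_succ_cong (ih Δ hΔ h)
  | nat_elim_cong L _ _ _ _ _ ihC ihC' ihz ihs ihn =>
    intro Δ hΔ h
    have hN (Θ : Cxt F K) : (Judgment.tm Θ .nat (.univ 0)).Weakens S := fun _ hΔ _ =>
      .nat_form hΔ.ctx
    have hC := weaken_under_top ihC (fun _ => rfl) (hN _) hΔ h
    exact .nat_elim_cong (L ∪ Δ.dom) hC (weaken_under_top ihC' (fun _ => rfl) (hN _) hΔ h)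
      (ihz Δ hΔ h) (weaken_under_two ihs (fun _ _ => rfl) (hN _) ihC hΔ h) (ihn Δ hΔ h)
  | id_form _ _ _ ihA iha ihb =>
    exact fun Δ hΔ h => .id_form (ihA Δ hΔ h) (iha Δ hΔ h) (ihb Δ hΔ h)
  | id_intro _ _ ihA iha => exact fun Δ hΔ h => .id_intro (ihA Δ hΔ h) (iha Δ hΔ h)
  | id_elim L _ _ _ _ _ _ ihA ihC ihc iha ihb ihp =>
    exact fun Δ hΔ h => .id_elim (L ∪ Δ.dom) (ihA Δ hΔ h)
      (weaken_under_id ihC (fun _ _ _ => rfl) ihA hΔ h)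
      (weaken_under_top ihc (fun _ => rfl) ihA hΔ h)
      (iha Δ hΔ h) (ihb Δ hΔ h) (ihp Δ hΔ h)
  | id_beta L _ _ _ _ ihA ihC ihc iha =>
    exact fun Δ hΔ h => .id_beta (L ∪ Δ.dom) (ihA Δ hΔ h)
      (weaken_under_id ihC (fun _ _ _ => rfl) ihA hΔ h)
      (weaken_under_top ihc (fun _ => rfl) ihA hΔ h) (iha Δ hΔ h)
  | id_form_cong _ _ _ ihA iha ihb =>
    exact fun Δ hΔ h => .id_form_cong (ihA Δ hΔ h) (iha Δ hΔ h) (ihb Δ hΔ h)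
  | id_intro_cong _ _ ihA iha =>
    exact fun Δ hΔ h => .id_intro_cong (ihA Δ hΔ h) (iha Δ hΔ h)
  | id_elim_cong L _ _ _ _ _ _ ihA ihC ihc iha ihb ihp =>
    exact fun Δ hΔ h => .id_elim_cong (L ∪ Δ.dom) (ihA Δ hΔ h)
      (weaken_under_id ihC (fun _ _ _ => rfl) ihA hΔ h)
      (weaken_under_top ihc (fun _ => rfl) ihA hΔ h)
      (iha Δ hΔ h) (ihb Δ hΔ h) (ihp Δ hΔ h)
  | flat_form _ _ _ ihA =>
    exact fun Δ hΔ h => .flat_form hΔ.ctx (ihA _ (hΔ.divide _) (h.divide _))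
  | flat_intro _ _ _ ihM =>
    exact fun Δ hΔ h => .flat_intro hΔ.ctx (ihM _ (hΔ.divide _) (h.divide _))
  | flat_elim L _ _ _ _ ihA ihC ihM ihN =>
    intro Δ hΔ h
    have hF : (Judgment.tm _ (.flat _ _) (.univ _)).Weakens S := fun Θ hΘ h =>
      .flat_form hΘ.ctx (ihA _ (hΘ.divide _) (by rw [← Cxt.divide_divide]; exact h.divide _))
    exact .flat_elim (L ∪ Δ.dom) (ihA _ (hΔ.divide _) (h.divide _))
      (weaken_under ihC (fun _ => rfl) hF hΔ h)
      (ihM _ (hΔ.divide _) (h.divide _)) (weaken_under ihN (fun _ => rfl) ihA hΔ h)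
  | flat_beta L _ _ _ _ ihA ihC ihM ihN =>
    intro Δ hΔ h
    have hF : (Judgment.tm _ (.flat _ _) (.univ _)).Weakens S := fun Θ hΘ h =>
      .flat_form hΘ.ctx (ihA _ (hΘ.divide _) (by rw [← Cxt.divide_divide]; exact h.divide _))
    exact .flat_beta (L ∪ Δ.dom) (ihA _ (hΔ.divide _) (h.divide _))
      (weaken_under ihC (fun _ => rfl) hF hΔ h)
      (ihM _ (hΔ.divide _) (h.divide _)) (weaken_under ihN (fun _ => rfl) ihA hΔ h)
  | flat_form_cong _ _ _ ihA =>
    exact fun Δ hΔ h => .flat_form_cong hΔ.ctx (ihA _ (hΔ.divide _) (h.divide _))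
  | flat_intro_cong _ _ _ ihM =>
    exact fun Δ hΔ h => .flat_intro_cong hΔ.ctx (ihM _ (hΔ.divide _) (h.divide _))
  | flat_elim_cong L _ _ _ _ ihA ihC ihM ihN =>
    intro Δ hΔ h
    have hF : (Judgment.tm _ (.flat _ _) (.univ _)).Weakens S := fun Θ hΘ h =>
      .flat_form hΘ.ctx (ihA _ (hΘ.divide _) (by rw [← Cxt.divide_divide]; exact h.divide _))
    exact .flat_elim_cong (L ∪ Δ.dom) (ihA _ (hΔ.divide _) (h.divide _))
      (weaken_under ihC (fun _ => rfl) hF hΔ h)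
      (ihM _ (hΔ.divide _) (h.divide _)) (weaken_under ihN (fun _ => rfl) ihA hΔ h)
  | sharp_form _ _ _ ihA =>
    exact fun Δ hΔ h => .sharp_form hΔ.ctx (ihA _ (hΔ.promote _) (h.promote _))
  | sharp_intro _ _ _ ihM =>
    exact fun Δ hΔ h => .sharp_intro hΔ.ctx (ihM _ (hΔ.promote _) (h.promote _))
  | sharp_elim _ _ _ ihN =>
    exact fun Δ hΔ h => .sharp_elim hΔ.ctx (ihN _ (hΔ.divide _) (h.divide _))
  | sharp_beta _ _ _ ihM =>
    exact fun Δ hΔ h => .sharp_beta hΔ.ctx (ihM _ (hΔ.divide _) (h.divide _))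
  | sharp_eta _ ihN => exact fun Δ hΔ h => .sharp_eta (ihN Δ hΔ h)
  | sharp_form_cong _ _ _ ihA =>
    exact fun Δ hΔ h => .sharp_form_cong hΔ.ctx (ihA _ (hΔ.promote _) (h.promote _))
  | sharp_intro_cong _ _ _ ihM =>
    exact fun Δ hΔ h => .sharp_intro_cong hΔ.ctx (ihM _ (hΔ.promote _) (h.promote _))
  | sharp_elim_cong _ _ _ ihN =>
    exact fun Δ hΔ h => .sharp_elim_cong hΔ.ctx (ihN _ (hΔ.divide _) (h.divide _))

/-- Every well-formed context is stable, by transport of the types that it declares. -/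
lemma stable (h : Derivable S (.ctx Γ)) : Γ.Stable S := by
  induction Γ with
  | nil =>
    intro Δ hΔ
    have : Δ = [] := by
      induction hΔ with
      | refl => rfl
      | promote φ _ ih => simp [ih, Cxt.promote]
      | divide φ _ ih => simp [ih, Cxt.divide]
    exact this ▸ .ctx_empty
  | cons e Γ ih =>
    cases h with
    | ctx_ext hΓ hA hx => exact stable_cons (ih hΓ) (.refl Γ) hA.weakens hx

lemma ctx_divide (h : Derivable S (.ctx Γ)) (φ : F) : Derivable S (.ctx (Γ.divide φ)) :=
  (h.stable.divide φ).ctx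

lemma ctx_promote (h : Derivable S (.ctx Γ)) (φ : F) : Derivable S (.ctx (Γ.promote φ)) :=
  (h.stable.promote φ).ctx

lemma weaken {a : Tm F K} (ha : Derivable S (.tm Γ a A)) (hΔ : Derivable S (.ctx Δ))
    (h : Γ.Sub Δ) : Derivable S (.tm Δ a A) :=
  ha.weakens Δ hΔ.stable h

end Derivable

/-! ### Derived rules for functions, identity types and equivalences -/

namespace Tm

variable {F : Type u} {K : Type v}

/-- The iterated application `f₁ (f₂ (⋯ (fₙ t)))`. -/
def apps (fs : List (Tm F K)) (t : Tm F K) : Tm F K := fs.foldr app t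

lemma openAt_apps {fs : List (Tm F K)} (h : ∀ f ∈ fs, f.LcAt 0) (s t : Tm F K) (k : ℕ) :
    openAt s k (apps fs t) = apps fs (openAt s k t) := by
  induction fs with
  | nil => rfl
  | cons f fs ih =>
    rw [List.forall_mem_cons] at h
    simp only [apps, List.foldr_cons, openAt, (h.1.mono (Nat.zero_le k)).openAt_eq] at ih ⊢
    rw [ih h.2]

end Tm

namespace Derivable

open Tm

variable {F : Type u} [SemilatticeInf F] [OrderTop F] {K : Type v} {S : Signature F K}
  {Γ Δ : Cxt F K} {φ ψ χ : F} {A B C a b f g f' g' M N T : Tm F K} {i j : ℕ}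

lemma openAt_eq (h : Derivable S (.tm Γ a A)) (s : Tm F K) (k : ℕ) : openAt s k a = a :=
  (h.lc.1.mono (Nat.zero_le k)).openAt_eq s

lemma open1_eq (h : Derivable S (.tm Γ a A)) (s : Tm F K) : open1 a s = a :=
  h.openAt_eq s 0

lemma ctx_cons_top (hΓ : Derivable S (.ctx Γ)) (hA : Derivable S (.tm Γ A (.univ i))) {x : ℕ}
    (hx : x ∉ Γ.dom) : Derivable S (.ctx (⟨x, ⊤, A⟩ :: Γ)) :=
  .ctx_ext hΓ (by rwa [Cxt.divide_top]) (Cxt.notMem_names hx)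

lemma var_head {x : ℕ} (h : Derivable S (.ctx (⟨x, χ, A⟩ :: Γ))) :
    Derivable S (.tm (⟨x, χ, A⟩ :: Γ) (fvar x) A) :=
  .var h List.mem_cons_self

lemma arrow_form (hΓ : Derivable S (.ctx Γ)) (hA : Derivable S (.tm Γ A (.univ i)))
    (hB : Derivable S (.tm Γ B (.univ i))) : Derivable S (.tm Γ (arrow A B) (.univ i)) :=
  .pi_form Γ.dom hA fun x hx => by
    rw [hB.open1_eq]
    exact hB.weaken (ctx_cons_top hΓ hA hx) (Cxt.Sub.refl Γ).weak

lemma lam_arrow (L : Finset ℕ) (hA : Derivable S (.tm Γ A (.univ i))) (hB : B.LcAt 0)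
    (hb : ∀ x ∉ L, Derivable S (.tm (⟨x, ⊤, A⟩ :: Γ) (open1 b (fvar x)) B)) :
    Derivable S (.tm Γ (lam A b) (arrow A B)) :=
  .pi_intro L hA fun x hx => by
    rw [open1.eq_def B, hB.openAt_eq]
    exact hb x hx

lemma app_arrow (hB : B.LcAt 0) (hf : Derivable S (.tm Γ f (arrow A B)))
    (ha : Derivable S (.tm Γ a A)) : Derivable S (.tm Γ (app f a) B) := by
  have := pi_elim hf ha
  rwa [open1, hB.openAt_eq] at this

lemma app_arrow_cong (hB : B.LcAt 0) (hf : Derivable S (.tm Γ f (arrow A B)))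
    (ha : Derivable S (.eq Γ a b A)) : Derivable S (.eq Γ (app f a) (app f b) B) := by
  have := pi_elim_cong (.eq_refl hf) ha
  rwa [open1, hB.openAt_eq] at this

lemma app_lam (L : Finset ℕ) (hA : Derivable S (.tm Γ A (.univ i))) (hB : B.LcAt 0)
    (hb : ∀ x ∉ L, Derivable S (.tm (⟨x, ⊤, A⟩ :: Γ) (open1 b (fvar x)) B))
    (ha : Derivable S (.tm Γ a A)) :
    Derivable S (.eq Γ (app (lam A b) a) (open1 b a) B) := by
  have := pi_beta (B := B) (b := b) L hA (fun x hx => by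
    rw [open1.eq_def B, hB.openAt_eq]
    exact hb x hx) ha
  rwa [open1.eq_def B, hB.openAt_eq] at this

/-- Definitionally equal terms are equal. -/
lemma refl_of_eq (hA : Derivable S (.tm Γ A (.univ i))) (hb : Derivable S (.tm Γ b A))
    (h : Derivable S (.eq Γ a b A)) : Derivable S (.tm Γ (refl b) (idt A a b)) :=
  .conv (.id_intro hA hb) (.id_form_cong (.eq_refl hA) (.eq_symm h) (.eq_refl hb))

/-- The type of proofs that `g` is a left inverse of `f`. -/
lemma pi_idt_form (hΓ : Derivable S (.ctx Γ)) (hA : Derivable S (.tm Γ A (.univ i)))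
    (hB : Derivable S (.tm Γ B (.univ i)))
    (hf : Derivable S (.tm Γ f (arrow A B))) (hg : Derivable S (.tm Γ g (arrow B A))) :
    Derivable S (.tm Γ (pi A (idt A (app g (app f (bvar 0))) (bvar 0))) (.univ i)) :=
  .pi_form Γ.dom hA fun x hx => by
    have hx := ctx_cons_top hΓ hA hx
    have hs : Γ.Sub (⟨x, ⊤, A⟩ :: Γ) := (Cxt.Sub.refl Γ).weak
    simp only [open1, openAt, hA.openAt_eq, hf.openAt_eq, hg.openAt_eq, if_true]
    exact .id_form (hA.weaken hx hs) (app_arrow hA.lc.1 (hg.weaken hx hs)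
      (app_arrow hB.lc.1 (hf.weaken hx hs) hx.var_head)) hx.var_head

lemma inhabited_isEquiv (hΓ : Derivable S (.ctx Γ)) (hA : Derivable S (.tm Γ A (.univ i)))
    (hB : Derivable S (.tm Γ B (.univ i)))
    (hf : Derivable S (.tm Γ f (arrow A B))) (hg : Derivable S (.tm Γ g (arrow B A)))
    (hl : S.Inhabited Γ (pi A (idt A (app g (app f (bvar 0))) (bvar 0))))
    (hr : S.Inhabited Γ (pi B (idt B (app f (app g (bvar 0))) (bvar 0)))) :
    S.Inhabited Γ (isEquiv A B f) := by
  obtain ⟨p, hp⟩ := hl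
  obtain ⟨q, hq⟩ := hr
  simp only [Signature.HasType] at hp hq
  have hBA := arrow_form hΓ hB hA
  have hl : ∀ x ∉ Γ.dom, Derivable S (.tm (⟨x, ⊤, arrow B A⟩ :: Γ)
      (open1 (pi A (idt A (app (bvar 1) (app f (bvar 0))) (bvar 0))) (fvar x)) (.univ i)) := by
    intro x hx
    have hx := ctx_cons_top hΓ hBA hx
    have hs : Γ.Sub (⟨x, ⊤, arrow B A⟩ :: Γ) := (Cxt.Sub.refl Γ).weak
    simpa [open1, openAt, hA.openAt_eq, hf.openAt_eq] using
      pi_idt_form hx (hA.weaken hx hs) (hB.weaken hx hs) (hf.weaken hx hs) hx.var_head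
  have hr : ∀ x ∉ Γ.dom, Derivable S (.tm (⟨x, ⊤, arrow B A⟩ :: Γ)
      (open1 (pi B (idt B (app f (app (bvar 1) (bvar 0))) (bvar 0))) (fvar x)) (.univ i)) := by
    intro x hx
    have hx := ctx_cons_top hΓ hBA hx
    have hs : Γ.Sub (⟨x, ⊤, arrow B A⟩ :: Γ) := (Cxt.Sub.refl Γ).weak
    simpa [open1, openAt, hB.openAt_eq, hf.openAt_eq] using
      pi_idt_form hx (hB.weaken hx hs) (hA.weaken hx hs) hx.var_head (hf.weaken hx hs)
  have hX := sigma_form _ hBA hl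
  have hY := sigma_form _ hBA hr
  refine ⟨pair (pair g p) (pair g q), .sigma_intro (i := i) Γ.dom hX ?_ ?_ ?_⟩
  · intro x hx
    rw [hY.open1_eq]
    exact hY.weaken (ctx_cons_top hΓ hX hx) (Cxt.Sub.refl Γ).weak
  · refine .sigma_intro _ hBA hl hg ?_
    simpa [open1, openAt, hA.openAt_eq, hf.openAt_eq] using hp
  · rw [hY.open1_eq]
    refine .sigma_intro _ hBA hr hg ?_
    simpa [open1, openAt, hB.openAt_eq, hf.openAt_eq] using hq

/-- Functions that are pointwise definitionally inverse to each other are definitionally inverse,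
by congruence for abstraction, and the first one is an equivalence, by reflexivity. -/
lemma isEquiv_and_defInverse (hΓ : Derivable S (.ctx Γ)) (hA : Derivable S (.tm Γ A (.univ i)))
    (hB : Derivable S (.tm Γ B (.univ i)))
    (hf : Derivable S (.tm Γ f (arrow A B))) (hg : Derivable S (.tm Γ g (arrow B A)))
    (hgf : ∀ x ∉ Γ.dom,
      Derivable S (.eq (⟨x, ⊤, A⟩ :: Γ) (app g (app f (fvar x))) (fvar x) A))
    (hfg : ∀ x ∉ Γ.dom,
      Derivable S (.eq (⟨x, ⊤, B⟩ :: Γ) (app f (app g (fvar x))) (fvar x) B)) :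
    S.Inhabited Γ (isEquiv A B f) ∧ S.DefInverse Γ A B f g := by
  have key : ∀ {A f g : Tm F K}, Derivable S (.tm Γ A (.univ i)) → f.LcAt 0 → g.LcAt 0 →
      (∀ x ∉ Γ.dom,
        Derivable S (.eq (⟨x, ⊤, A⟩ :: Γ) (app g (app f (fvar x))) (fvar x) A)) →
      S.Inhabited Γ (pi A (idt A (app g (app f (bvar 0))) (bvar 0))) ∧
        S.DefEq Γ (comp A g f) (idFun A) (arrow A A) := by
    intro A f g hA hf hg h
    refine ⟨⟨lam A (refl (bvar 0)), .pi_intro Γ.dom hA fun x hx => ?_⟩,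
      .pi_intro_cong Γ.dom hA (.eq_refl hA) fun x hx => ?_⟩
    · simp only [open1, openAt, hA.openAt_eq, hf.openAt_eq, hg.openAt_eq, if_true]
      have hx' := ctx_cons_top hΓ hA hx
      exact refl_of_eq (hA.weaken hx' (Cxt.Sub.refl Γ).weak) hx'.var_head (h x hx)
    · simpa only [open1, openAt, hA.openAt_eq, hf.openAt_eq, hg.openAt_eq, if_true] using h x hx
  obtain ⟨h1, h2⟩ := key hA hf.lc.1 hg.lc.1 hgf
  obtain ⟨h3, h4⟩ := key hB hg.lc.1 hf.lc.1 hfg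
  exact ⟨inhabited_isEquiv hΓ hA hB hf hg h1 h3, hf, hg, h2, h4⟩

/-! ### The comodalities -/

lemma weaken_crisp (ha : Derivable S (.tm (Γ.divide χ) a A)) (hΔ : Derivable S (.ctx Δ))
    (h : Γ.Sub Δ) : Derivable S (.tm (Δ.divide χ) a A) :=
  ha.weaken (hΔ.ctx_divide χ) (h.divide χ)

lemma var_head_crisp {x : ℕ} (h : Derivable S (.ctx (⟨x, χ, A⟩ :: Γ))) (hχ : χ ≤ φ) :
    Derivable S (.tm (Cxt.divide φ (⟨x, χ, A⟩ :: Γ)) (fvar x) A) :=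
  .var (h.ctx_divide φ) (Cxt.mem_divide.2 ⟨List.mem_cons_self, hχ⟩)

lemma flat_flat_form (hΓ : Derivable S (.ctx Γ))
    (hA : Derivable S (.tm (Γ.divide (φ ⊓ ψ)) A (.univ i))) :
    Derivable S (.tm Γ (flat φ (flat ψ A)) (.univ i)) :=
  .flat_form hΓ (.flat_form (hΓ.ctx_divide φ) (by rwa [Cxt.divide_divide]))

lemma flat_flat_intro (hΓ : Derivable S (.ctx Γ))
    (hM : Derivable S (.tm (Γ.divide (φ ⊓ ψ)) M A)) :
    Derivable S (.tm Γ (flatIntro φ (flatIntro ψ M)) (flat φ (flat ψ A))) :=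
  .flat_intro hΓ (.flat_intro (hΓ.ctx_divide φ) (by rwa [Cxt.divide_divide]))

lemma ctx_cons_flat (hΓ : Derivable S (.ctx Γ))
    (hA : Derivable S (.tm (Γ.divide (ψ ⊓ φ)) A (.univ i))) {x : ℕ} (hx : x ∉ Γ.dom) :
    Derivable S (.ctx (⟨x, ψ, flat φ A⟩ :: Γ)) :=
  .ctx_ext hΓ (.flat_form (hΓ.ctx_divide ψ) (by rwa [Cxt.divide_divide])) (Cxt.notMem_names hx)

/-- Crisp induction for `♭_φ` into a constant family. -/
lemma flat_rec (hχ : ψ ⊓ φ = χ) (hΓ : Derivable S (.ctx Γ))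
    (hA : Derivable S (.tm (Γ.divide χ) A (.univ i))) (hC : Derivable S (.tm Γ C (.univ j)))
    (hM : Derivable S (.tm (Γ.divide ψ) M (flat φ A)))
    (hN : ∀ y ∉ Γ.dom, Derivable S (.tm (⟨y, χ, A⟩ :: Γ) (open1 N (fvar y)) C)) :
    Derivable S (.tm Γ (flatInd φ M N) C) := by
  subst hχ
  have := flat_elim (C := C) (N := N) Γ.dom hA (fun x hx => by
    rw [hC.open1_eq]
    exact hC.weaken (ctx_cons_flat hΓ hA hx) (Cxt.Sub.refl Γ).weak) hM
    (fun y hy => by rw [hC.open1_eq]; exact hN y hy)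
  rwa [hC.open1_eq] at this

lemma flat_rec_beta (hχ : ψ ⊓ φ = χ) (hΓ : Derivable S (.ctx Γ))
    (hA : Derivable S (.tm (Γ.divide χ) A (.univ i))) (hC : Derivable S (.tm Γ C (.univ j)))
    (hM : Derivable S (.tm (Γ.divide χ) M A))
    (hN : ∀ y ∉ Γ.dom, Derivable S (.tm (⟨y, χ, A⟩ :: Γ) (open1 N (fvar y)) C)) :
    Derivable S (.eq Γ (flatInd φ (flatIntro φ M) N) (open1 N M) C) := by
  subst hχ
  have := flat_beta (C := C) (N := N) Γ.dom hA (fun x hx => by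
    rw [hC.open1_eq]
    exact hC.weaken (ctx_cons_flat hΓ hA hx) (Cxt.Sub.refl Γ).weak) hM
    (fun y hy => by rw [hC.open1_eq]; exact hN y hy)
  rwa [hC.open1_eq] at this

lemma flatMap_body (hΓ : Derivable S (.ctx Γ))
    (hA : Derivable S (.tm (Γ.divide φ) A (.univ i)))
    (hB : Derivable S (.tm (Γ.divide φ) B (.univ j)))
    (hf : Derivable S (.tm (Γ.divide φ) f (arrow A B))) :
    ∀ y ∉ Γ.dom, Derivable S
      (.tm (⟨y, φ, A⟩ :: Γ) (open1 (flatIntro φ (app f (bvar 0))) (fvar y)) (flat φ B)) := by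
  intro y hy
  have hy := Derivable.ctx_ext hΓ hA (Cxt.notMem_names hy)
  simp only [open1, openAt, hf.openAt_eq, if_true]
  exact .flat_intro hy (app_arrow hB.lc.1 (hf.weaken_crisp hy (Cxt.Sub.refl Γ).weak)
    (hy.var_head_crisp le_rfl))

lemma flatMap_inner (hΓ : Derivable S (.ctx Γ))
    (hA : Derivable S (.tm (Γ.divide φ) A (.univ i)))
    (hB : Derivable S (.tm (Γ.divide φ) B (.univ j)))
    (hf : Derivable S (.tm (Γ.divide φ) f (arrow A B))) :
    ∀ x ∉ Γ.dom, Derivable S (.tm (⟨x, ⊤, flat φ A⟩ :: Γ)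
      (open1 (flatInd φ (bvar 0) (flatIntro φ (app f (bvar 0)))) (fvar x)) (flat φ B)) := by
  intro x hx
  have hx := ctx_cons_top hΓ (.flat_form hΓ hA) hx
  have hs : Γ.Sub (⟨x, ⊤, flat φ A⟩ :: Γ) := (Cxt.Sub.refl Γ).weak
  have hA' := hA.weaken_crisp hx hs
  have hB' := hB.weaken_crisp hx hs
  have := flat_rec (ψ := ⊤) (top_inf_eq φ) hx hA' (.flat_form hx hB')
    (hx.var_head_crisp le_rfl) (flatMap_body hx hA' hB' (hf.weaken_crisp hx hs))
  simpa [open1, openAt, hf.openAt_eq] using this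

lemma flatMap_hasType (hΓ : Derivable S (.ctx Γ))
    (hA : Derivable S (.tm (Γ.divide φ) A (.univ i)))
    (hB : Derivable S (.tm (Γ.divide φ) B (.univ j)))
    (hf : Derivable S (.tm (Γ.divide φ) f (arrow A B))) :
    Derivable S (.tm Γ (flatMap φ A f) (arrow (flat φ A) (flat φ B))) :=
  lam_arrow Γ.dom (.flat_form hΓ hA) hB.lc.1 (flatMap_inner hΓ hA hB hf)

lemma flatMap_flatIntro (hΓ : Derivable S (.ctx Γ))
    (hA : Derivable S (.tm (Γ.divide φ) A (.univ i)))
    (hB : Derivable S (.tm (Γ.divide φ) B (.univ j)))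
    (hf : Derivable S (.tm (Γ.divide φ) f (arrow A B)))
    (hM : Derivable S (.tm (Γ.divide φ) M A)) :
    Derivable S (.eq Γ (app (flatMap φ A f) (flatIntro φ M)) (flatIntro φ (app f M))
      (flat φ B)) := by
  have h1 := app_lam (B := flat φ B) Γ.dom (.flat_form hΓ hA) hB.lc.1 (flatMap_inner hΓ hA hB hf)
    (.flat_intro hΓ hM)
  have h2 := flat_rec_beta (ψ := ⊤) (top_inf_eq φ) hΓ hA (.flat_form hΓ hB) hM
    (flatMap_body hΓ hA hB hf)
  simp only [open1, openAt, hf.openAt_eq, if_true] at h1 h2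
  simp only [zero_add, zero_ne_one, if_false] at h1
  exact .eq_trans h1 h2

lemma flatFlatMap_hasType (hΓ : Derivable S (.ctx Γ))
    (hA : Derivable S (.tm (Γ.divide (φ ⊓ ψ)) A (.univ i)))
    (hB : Derivable S (.tm (Γ.divide (φ ⊓ ψ)) B (.univ j)))
    (hf : Derivable S (.tm (Γ.divide (φ ⊓ ψ)) f (arrow A B))) :
    Derivable S (.tm Γ (flatFlatMap φ ψ A f)
      (arrow (flat φ (flat ψ A)) (flat φ (flat ψ B)))) := by
  have hΓφ := hΓ.ctx_divide φ
  rw [← Cxt.divide_divide] at hA hB hf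
  exact flatMap_hasType hΓ (.flat_form hΓφ hA) (.flat_form hΓφ hB)
    (flatMap_hasType hΓφ hA hB hf)

lemma flatFlatMap_flatIntro (hΓ : Derivable S (.ctx Γ))
    (hA : Derivable S (.tm (Γ.divide (φ ⊓ ψ)) A (.univ i)))
    (hB : Derivable S (.tm (Γ.divide (φ ⊓ ψ)) B (.univ j)))
    (hf : Derivable S (.tm (Γ.divide (φ ⊓ ψ)) f (arrow A B)))
    (hM : Derivable S (.tm (Γ.divide (φ ⊓ ψ)) M A)) :
    Derivable S (.eq Γ (app (flatFlatMap φ ψ A f) (flatIntro φ (flatIntro ψ M)))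
      (flatIntro φ (flatIntro ψ (app f M))) (flat φ (flat ψ B))) := by
  have hΓφ := hΓ.ctx_divide φ
  rw [← Cxt.divide_divide] at hA hB hf hM
  exact .eq_trans
    (flatMap_flatIntro hΓ (.flat_form hΓφ hA) (.flat_form hΓφ hB)
      (flatMap_hasType hΓφ hA hB hf) (.flat_intro hΓφ hM))
    (.flat_intro_cong hΓ (flatMap_flatIntro hΓφ hA hB hf hM))

/-! ### Commuting two comodalities -/

lemma flatComm_body (hΓ : Derivable S (.ctx Γ))
    (hA : Derivable S (.tm (Γ.divide (φ ⊓ ψ)) A (.univ i))) :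
    ∀ w ∉ Γ.dom, Derivable S (.tm (⟨w, φ ⊓ ψ, A⟩ :: Γ)
      (open1 (flatIntro ψ (flatIntro φ (bvar 0))) (fvar w)) (flat ψ (flat φ A))) := by
  intro w hw
  have hw := Derivable.ctx_ext hΓ hA (Cxt.notMem_names hw)
  simp only [open1, openAt, if_true]
  exact flat_flat_intro hw (hw.var_head_crisp (inf_comm φ ψ).le)

/-- The inner `let`, under the `φ`-crisp variable `v : ♭_ψ A`: here `♭_ψ`-induction is used
`φ`-crisply, which makes the new variable `φψ`-crisp. -/
lemma flatComm_inner (hΓ : Derivable S (.ctx Γ))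
    (hA : Derivable S (.tm (Γ.divide (φ ⊓ ψ)) A (.univ i))) :
    ∀ v ∉ Γ.dom, Derivable S (.tm (⟨v, φ, flat ψ A⟩ :: Γ)
      (open1 (flatInd ψ (bvar 0) (flatIntro ψ (flatIntro φ (bvar 0)))) (fvar v))
      (flat ψ (flat φ A))) := by
  intro v hv
  have hv := ctx_cons_flat hΓ hA hv
  have hA' := hA.weaken_crisp hv (Cxt.Sub.refl Γ).weak
  have := flat_rec rfl hv hA' (flat_flat_form hv (by rwa [inf_comm])) (hv.var_head_crisp le_rfl)
    (flatComm_body hv hA')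
  simpa [open1, openAt] using this

lemma flatComm_outer (hΓ : Derivable S (.ctx Γ))
    (hA : Derivable S (.tm (Γ.divide (φ ⊓ ψ)) A (.univ i))) :
    ∀ u ∉ Γ.dom, Derivable S (.tm (⟨u, ⊤, flat φ (flat ψ A)⟩ :: Γ)
      (open1 (flatInd φ (bvar 0) (flatInd ψ (bvar 0) (flatIntro ψ (flatIntro φ (bvar 0)))))
        (fvar u)) (flat ψ (flat φ A))) := by
  intro u hu
  have hu := ctx_cons_top hΓ (flat_flat_form hΓ hA) hu
  have hA' := hA.weaken_crisp hu (Cxt.Sub.refl Γ).weak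
  have := flat_rec (ψ := ⊤) (top_inf_eq φ) hu
    (.flat_form (hu.ctx_divide φ) (by rwa [Cxt.divide_divide]))
    (flat_flat_form hu (by rwa [inf_comm])) (hu.var_head_crisp le_rfl) (flatComm_inner hu hA')
  simpa [open1, openAt] using this

lemma flatComm_hasType (hΓ : Derivable S (.ctx Γ))
    (hA : Derivable S (.tm (Γ.divide (φ ⊓ ψ)) A (.univ i))) :
    Derivable S (.tm Γ (flatComm φ ψ A)
      (arrow (flat φ (flat ψ A)) (flat ψ (flat φ A)))) :=
  lam_arrow Γ.dom (flat_flat_form hΓ hA) hA.lc.1 (flatComm_outer hΓ hA)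

lemma flatComm_flatIntro (hΓ : Derivable S (.ctx Γ))
    (hA : Derivable S (.tm (Γ.divide (φ ⊓ ψ)) A (.univ i)))
    (hM : Derivable S (.tm (Γ.divide (φ ⊓ ψ)) M A)) :
    Derivable S (.eq Γ (app (flatComm φ ψ A) (flatIntro φ (flatIntro ψ M)))
      (flatIntro ψ (flatIntro φ M)) (flat ψ (flat φ A))) := by
  have hC : Derivable S (.tm Γ (flat ψ (flat φ A)) (.univ i)) :=
    flat_flat_form hΓ (by rwa [inf_comm])
  have h1 := app_lam Γ.dom (flat_flat_form hΓ hA) hC.lc.1 (flatComm_outer hΓ hA)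
    (flat_flat_intro hΓ hM)
  have h2 := flat_rec_beta (ψ := ⊤) (top_inf_eq φ) hΓ
    (.flat_form (hΓ.ctx_divide φ) (by rwa [Cxt.divide_divide])) hC
    (M := flatIntro ψ M) (.flat_intro (hΓ.ctx_divide φ) (by rwa [Cxt.divide_divide]))
    (flatComm_inner hΓ hA)
  have h3 := flat_rec_beta rfl hΓ hA hC hM (flatComm_body hΓ hA)
  simp only [open1, openAt, if_true, zero_add, OfNat.zero_ne_ofNat, zero_ne_one,
    if_false, Nat.reduceAdd] at h1 h2 h3
  exact .eq_trans h1 (.eq_trans h2 h3)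

/-- Two functions on `♭_φ ♭_ψ A`, given as iterated applications, are homotopic if they agree
definitionally on the elements `(w^{♭_ψ})^{♭_φ}` with `w` a `φψ`-crisp variable.  This is
`♭_φ`-induction, followed by `φ`-crisp `♭_ψ`-induction. -/
lemma inhabited_pi_flat_flat {fs gs : List (Tm F K)} (hΓ : Derivable S (.ctx Γ))
    (hA : Derivable S (.tm (Γ.divide (φ ⊓ ψ)) A (.univ i)))
    (hT : Derivable S (.tm Γ T (.univ j)))
    (hfs : ∀ f ∈ fs, f.LcAt 0) (hgs : ∀ g ∈ gs, g.LcAt 0)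
    (hf : ∀ (Δ : Cxt F K) (M : Tm F K), Derivable S (.ctx Δ) → Γ.Sub Δ →
      Derivable S (.tm Δ M (flat φ (flat ψ A))) → Derivable S (.tm Δ (apps fs M) T))
    (hg : ∀ (Δ : Cxt F K) (M : Tm F K), Derivable S (.ctx Δ) → Γ.Sub Δ →
      Derivable S (.tm Δ M (flat φ (flat ψ A))) → Derivable S (.tm Δ (apps gs M) T))
    (h : ∀ (Δ : Cxt F K) (M : Tm F K), Derivable S (.ctx Δ) → Γ.Sub Δ →
      Derivable S (.tm (Δ.divide (φ ⊓ ψ)) M A) →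
      Derivable S (.eq Δ (apps fs (flatIntro φ (flatIntro ψ M)))
        (apps gs (flatIntro φ (flatIntro ψ M))) T)) :
    S.Inhabited Γ (pi (flat φ (flat ψ A)) (idt T (apps fs (bvar 0)) (apps gs (bvar 0)))) := by
  have ho := fun s t k => openAt_apps hfs s t k
  have ho' := fun s t k => openAt_apps hgs s t k
  refine ⟨lam (flat φ (flat ψ A)) (flatInd φ (bvar 0) (flatInd ψ (bvar 0)
    (refl (apps gs (flatIntro φ (flatIntro ψ (bvar 0))))))),
    .pi_intro Γ.dom (flat_flat_form hΓ hA) fun u hu => ?_⟩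
  have hu := ctx_cons_top hΓ (flat_flat_form hΓ hA) hu
  have hs : Γ.Sub (⟨u, ⊤, flat φ (flat ψ A)⟩ :: Γ) := (Cxt.Sub.refl Γ).weak
  have hA' := hA.weaken_crisp hu hs
  have hFA := flat_form (hu.ctx_divide φ) (by rwa [Cxt.divide_divide])
  -- The motive of the outer induction is the goal itself; that of the inner one is its instance
  -- at `y^{♭_φ}`, with `y` a `φ`-crisp variable of type `♭_ψ A`.
  have key := flat_elim (φ := φ) (ψ := ⊤) (A := flat ψ A) (i := i) (j := j)
    (C := idt T (apps fs (bvar 0)) (apps gs (bvar 0)))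
    (N := flatInd ψ (bvar 0) (refl (apps gs (flatIntro φ (flatIntro ψ (bvar 0))))))
    (Cxt.dom (⟨u, ⊤, flat φ (flat ψ A)⟩ :: Γ)) (by rwa [top_inf_eq])
    (fun x hx => ?_) (hu.var_head_crisp le_rfl) (fun v hv => ?_)
  · simpa [open1, openAt, ho, ho', hT.openAt_eq] using key
  · have hx := ctx_cons_flat hu (by rwa [top_inf_eq]) hx
    simp only [open1, openAt, ho, ho', hT.openAt_eq, if_true]
    exact .id_form (hT.weaken hx hs.weak) (hf _ _ hx hs.weak hx.var_head)
      (hg _ _ hx hs.weak hx.var_head)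
  · rw [top_inf_eq]
    have hv := ctx_cons_flat hu hA' hv
    have hA'' := hA.weaken_crisp hv hs.weak
    have key := flat_elim (φ := ψ) (ψ := φ) (A := A) (i := i) (j := j)
      (C := idt T (apps fs (flatIntro φ (bvar 0))) (apps gs (flatIntro φ (bvar 0))))
      (N := refl (apps gs (flatIntro φ (flatIntro ψ (bvar 0)))))
      (Cxt.dom (⟨v, φ, flat ψ A⟩ :: ⟨u, ⊤, flat φ (flat ψ A)⟩ :: Γ)) hA''
      (fun y hy => ?_) (hv.var_head_crisp le_rfl) (fun w hw => ?_)
    · simpa [open1, openAt, ho, ho', hT.openAt_eq] using key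
    · have hy := ctx_cons_flat hv hA'' hy
      have hM := flat_intro hy (hy.var_head_crisp le_rfl)
      simp only [open1, openAt, ho, ho', hT.openAt_eq, if_true]
      exact .id_form (hT.weaken hy hs.weak.weak) (hf _ _ hy hs.weak.weak hM)
        (hg _ _ hy hs.weak.weak hM)
    · have hw := Derivable.ctx_ext hv hA'' (Cxt.notMem_names hw)
      simp only [open1, openAt, ho, ho', hT.openAt_eq, if_true]
      exact refl_of_eq (hT.weaken hw hs.weak.weak)
        (hg _ _ hw hs.weak.weak (flat_flat_intro hw (hw.var_head_crisp le_rfl)))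
        (h _ _ hw hs.weak.weak (hw.var_head_crisp le_rfl))

lemma flatComm_flatComm (hΓ : Derivable S (.ctx Γ))
    (hA : Derivable S (.tm (Γ.divide (φ ⊓ ψ)) A (.univ i))) :
    S.Inhabited Γ (pi (flat φ (flat ψ A)) (idt (flat φ (flat ψ A))
      (app (flatComm ψ φ A) (app (flatComm φ ψ A) (bvar 0))) (bvar 0))) := by
  have hA' : Derivable S (.tm (Γ.divide (ψ ⊓ φ)) A (.univ i)) := by rwa [inf_comm]
  have hc := flatComm_hasType hΓ hA
  have hc' := flatComm_hasType hΓ hA'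
  refine inhabited_pi_flat_flat (fs := [flatComm ψ φ A, flatComm φ ψ A]) (gs := []) hΓ hA
    (flat_flat_form hΓ hA) ?_ (by simp) ?_ (fun Δ M _ _ hM => hM) ?_
  · simpa using ⟨hc'.lc.1, hc.lc.1⟩
  · exact fun Δ M hΔ hs hM => app_arrow hA.lc.1 (hc'.weaken hΔ hs)
      (app_arrow hA.lc.1 (hc.weaken hΔ hs) hM)
  · intro Δ M hΔ hs hM
    exact .eq_trans (app_arrow_cong hA.lc.1 (hc'.weaken hΔ hs)
        (flatComm_flatIntro hΔ (hA.weaken_crisp hΔ hs) hM))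
      (flatComm_flatIntro hΔ (hA'.weaken_crisp hΔ hs) (by rwa [inf_comm]))

lemma flatComm_natural (hΓ : Derivable S (.ctx Γ))
    (hA : Derivable S (.tm (Γ.divide (φ ⊓ ψ)) A (.univ i)))
    (hB : Derivable S (.tm (Γ.divide (φ ⊓ ψ)) B (.univ j)))
    (hf : Derivable S (.tm (Γ.divide (φ ⊓ ψ)) f (arrow A B))) :
    S.Inhabited Γ (pi (flat φ (flat ψ A)) (idt (flat ψ (flat φ B))
      (app (flatFlatMap ψ φ A f) (app (flatComm φ ψ A) (bvar 0)))
      (app (flatComm φ ψ B) (app (flatFlatMap φ ψ A f) (bvar 0))))) := by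
  have hA' : Derivable S (.tm (Γ.divide (ψ ⊓ φ)) A (.univ i)) := by rwa [inf_comm]
  have hB' : Derivable S (.tm (Γ.divide (ψ ⊓ φ)) B (.univ j)) := by rwa [inf_comm]
  have hf' : Derivable S (.tm (Γ.divide (ψ ⊓ φ)) f (arrow A B)) := by rwa [inf_comm]
  have hcA := flatComm_hasType hΓ hA
  have hcB := flatComm_hasType hΓ hB
  have hm := flatFlatMap_hasType hΓ hA hB hf
  have hm' := flatFlatMap_hasType hΓ hA' hB' hf'
  refine inhabited_pi_flat_flat (fs := [flatFlatMap ψ φ A f, flatComm φ ψ A])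
    (gs := [flatComm φ ψ B, flatFlatMap φ ψ A f]) hΓ hA (flat_flat_form hΓ hB') ?_ ?_ ?_ ?_ ?_
  · simpa using ⟨hm'.lc.1, hcA.lc.1⟩
  · simpa using ⟨hcB.lc.1, hm.lc.1⟩
  · exact fun Δ M hΔ hs hM => app_arrow hB.lc.1 (hm'.weaken hΔ hs)
      (app_arrow hA.lc.1 (hcA.weaken hΔ hs) hM)
  · exact fun Δ M hΔ hs hM => app_arrow hB.lc.1 (hcB.weaken hΔ hs)
      (app_arrow hB.lc.1 (hm.weaken hΔ hs) hM)
  · intro Δ M hΔ hs hM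
    have hl := Derivable.eq_trans (app_arrow_cong (B := flat ψ (flat φ B)) hB.lc.1 (hm'.weaken hΔ hs)
        (flatComm_flatIntro hΔ (hA.weaken_crisp hΔ hs) hM))
      (flatFlatMap_flatIntro hΔ (hA'.weaken_crisp hΔ hs) (hB'.weaken_crisp hΔ hs)
        (hf'.weaken_crisp hΔ hs) (by rwa [inf_comm]))
    have hr := Derivable.eq_trans (app_arrow_cong (B := flat ψ (flat φ B)) hB.lc.1 (hcB.weaken hΔ hs)
        (flatFlatMap_flatIntro hΔ (hA.weaken_crisp hΔ hs) (hB.weaken_crisp hΔ hs)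
          (hf.weaken_crisp hΔ hs) hM))
      (flatComm_flatIntro hΔ (hB.weaken_crisp hΔ hs)
        (app_arrow hB.lc.1 (hf.weaken_crisp hΔ hs) hM))
    exact .eq_trans hl (.eq_symm hr)

end Derivable

/-! ### The modalities -/

namespace Derivable

open Tm

variable {F : Type u} [SemilatticeInf F] [OrderTop F] {K : Type v} {S : Signature F K}
  {Γ Δ : Cxt F K} {φ ψ χ : F} {A B M N N' : Tm F K} {i : ℕ}

/-- Stronger focuses make variables no less usable, so derivable typings survive promotion. -/
lemma to_promote (hΓ : Derivable S (.ctx Γ)) (h : Derivable S (.tm Γ M A)) (χ : F) :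
    Derivable S (.tm (Γ.promote χ) M A) :=
  h.weaken (hΓ.ctx_promote χ) (.promote_right Γ χ)

/-- In a context in which every variable is `φ`-crisp, `♯_φ` can be eliminated freely. -/
lemma sharpElim_promote (hΓ : Derivable S (.ctx Γ)) (hχ : χ ≤ φ)
    (hN : Derivable S (.tm (Γ.promote χ) N (sharp φ A))) :
    Derivable S (.tm (Γ.promote χ) (sharpElim φ N) A) :=
  .sharp_elim (hΓ.ctx_promote χ) (by rwa [Cxt.divide_promote_of_le hχ])

lemma sharpElim_promote_cong (hΓ : Derivable S (.ctx Γ)) (hχ : χ ≤ φ)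
    (hN : Derivable S (.eq (Γ.promote χ) N N' (sharp φ A))) :
    Derivable S (.eq (Γ.promote χ) (sharpElim φ N) (sharpElim φ N') A) :=
  .sharp_elim_cong (hΓ.ctx_promote χ) (by rwa [Cxt.divide_promote_of_le hχ])

lemma sharpElim_sharpIntro_promote (hΓ : Derivable S (.ctx Γ)) (hχ : χ ≤ φ)
    (hM : Derivable S (.tm (Γ.promote χ) M A)) :
    Derivable S (.eq (Γ.promote χ) (sharpElim φ (sharpIntro φ M)) M A) :=
  .sharp_beta (hΓ.ctx_promote χ) (by rwa [Cxt.divide_promote_of_le hχ])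

lemma sharp_sharp_form (hΓ : Derivable S (.ctx Γ))
    (hB : Derivable S (.tm (Γ.promote (φ ⊓ ψ)) B (.univ i))) :
    Derivable S (.tm Γ (sharp φ (sharp ψ B)) (.univ i)) :=
  .sharp_form hΓ (.sharp_form (hΓ.ctx_promote φ) (by rwa [Cxt.promote_promote]))

lemma sharp_sharp_intro (hΓ : Derivable S (.ctx Γ))
    (hM : Derivable S (.tm (Γ.promote (φ ⊓ ψ)) M B)) :
    Derivable S (.tm Γ (sharpIntro φ (sharpIntro ψ M)) (sharp φ (sharp ψ B))) :=
  .sharp_intro hΓ (.sharp_intro (hΓ.ctx_promote φ) (by rwa [Cxt.promote_promote]))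

lemma sharp_sharp_intro_cong (hΓ : Derivable S (.ctx Γ))
    (hM : Derivable S (.eq (Γ.promote (φ ⊓ ψ)) M N B)) :
    Derivable S (.eq Γ (sharpIntro φ (sharpIntro ψ M)) (sharpIntro φ (sharpIntro ψ N))
      (sharp φ (sharp ψ B))) :=
  .sharp_intro_cong hΓ (.sharp_intro_cong (hΓ.ctx_promote φ) (by rwa [Cxt.promote_promote]))

lemma sharp_sharp_elim (hΓ : Derivable S (.ctx Γ)) (hφ : χ ≤ φ) (hψ : χ ≤ ψ)
    (hN : Derivable S (.tm Γ N (sharp φ (sharp ψ B)))) :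
    Derivable S (.tm (Γ.promote χ) (sharpElim ψ (sharpElim φ N)) B) :=
  sharpElim_promote hΓ hψ (sharpElim_promote hΓ hφ (to_promote hΓ hN χ))

lemma sharp_sharp_beta (hΓ : Derivable S (.ctx Γ)) (hφ : χ ≤ φ) (hψ : χ ≤ ψ)
    (hM : Derivable S (.tm (Γ.promote χ) M B)) :
    Derivable S (.eq (Γ.promote χ)
      (sharpElim ψ (sharpElim φ (sharpIntro φ (sharpIntro ψ M)))) M B) :=
  have hΓχ := hΓ.ctx_promote χ
  .eq_trans
    (sharpElim_promote_cong hΓ hψ (sharpElim_sharpIntro_promote hΓ hφ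
      (.sharp_intro hΓχ (to_promote hΓχ hM ψ))))
    (sharpElim_sharpIntro_promote hΓ hψ hM)

lemma sharp_sharp_eta (hΓ : Derivable S (.ctx Γ))
    (hN : Derivable S (.tm Γ N (sharp φ (sharp ψ B)))) :
    Derivable S (.eq Γ (sharpIntro φ (sharpIntro ψ (sharpElim ψ (sharpElim φ N)))) N
      (sharp φ (sharp ψ B))) :=
  .eq_symm (.eq_trans (.sharp_eta hN) (.sharp_intro_cong hΓ
    (.sharp_eta (sharpElim_promote hΓ le_rfl (to_promote hΓ hN φ)))))

/-- A function whose body is given by an operation `op` on terms is well-typed and computes to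
`op` in every larger context, provided that `op` preserves typing there. -/
lemma lam_arrow_of_open {b : Tm F K} {op : Tm F K → Tm F K} (hop : ∀ s, open1 b s = op s)
    (hΓ : Derivable S (.ctx Γ)) (hA : Derivable S (.tm Γ A (.univ i))) (hB : B.LcAt 0)
    (hb : ∀ (Δ : Cxt F K) (N : Tm F K), Derivable S (.ctx Δ) → Γ.Sub Δ →
      Derivable S (.tm Δ N A) → Derivable S (.tm Δ (op N) B)) :
    Derivable S (.tm Γ (lam A b) (arrow A B)) ∧
      ∀ (Δ : Cxt F K) (N : Tm F K), Derivable S (.ctx Δ) → Γ.Sub Δ →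
        Derivable S (.tm Δ N A) → Derivable S (.eq Δ (app (lam A b) N) (op N) B) := by
  refine ⟨lam_arrow Γ.dom hA hB fun x hx => ?_, fun Δ N hΔ hs hN => ?_⟩
  · have hx := ctx_cons_top hΓ hA hx
    rw [hop]
    exact hb _ _ hx (Cxt.Sub.refl Γ).weak hx.var_head
  · rw [← hop]
    refine app_lam Δ.dom (hA.weaken hΔ hs) hB (fun x hx => ?_) hN
    have hx := ctx_cons_top hΔ (hA.weaken hΔ hs) hx
    rw [hop]
    exact hb _ _ hx hs.weak hx.var_head

lemma sharpComm_hasType_and_app (hΓ : Derivable S (.ctx Γ))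
    (hB : Derivable S (.tm (Γ.promote (φ ⊓ ψ)) B (.univ i))) :
    Derivable S (.tm Γ (sharpComm φ ψ B)
      (arrow (sharp φ (sharp ψ B)) (sharp ψ (sharp φ B)))) ∧
    ∀ (Δ : Cxt F K) (N : Tm F K), Derivable S (.ctx Δ) → Γ.Sub Δ →
      Derivable S (.tm Δ N (sharp φ (sharp ψ B))) →
      Derivable S (.eq Δ (app (sharpComm φ ψ B) N)
        (sharpIntro ψ (sharpIntro φ (sharpElim ψ (sharpElim φ N)))) (sharp ψ (sharp φ B))) :=
  lam_arrow_of_open (fun _ => rfl) hΓ (sharp_sharp_form hΓ hB) hB.lc.1 fun _ _ hΔ _ hN =>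
    sharp_sharp_intro hΔ (sharp_sharp_elim hΔ inf_le_right inf_le_left hN)

lemma sharpMerge_hasType_and_app (hΓ : Derivable S (.ctx Γ))
    (hB : Derivable S (.tm (Γ.promote (φ ⊓ ψ)) B (.univ i))) :
    Derivable S (.tm Γ (sharpMerge φ ψ B)
      (arrow (sharp φ (sharp ψ B)) (sharp (φ ⊓ ψ) B))) ∧
    ∀ (Δ : Cxt F K) (N : Tm F K), Derivable S (.ctx Δ) → Γ.Sub Δ →
      Derivable S (.tm Δ N (sharp φ (sharp ψ B))) →
      Derivable S (.eq Δ (app (sharpMerge φ ψ B) N)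
        (sharpIntro (φ ⊓ ψ) (sharpElim ψ (sharpElim φ N))) (sharp (φ ⊓ ψ) B)) :=
  lam_arrow_of_open (fun _ => rfl) hΓ (sharp_sharp_form hΓ hB) hB.lc.1 fun _ _ hΔ _ hN =>
    .sharp_intro hΔ (sharp_sharp_elim hΔ inf_le_left inf_le_right hN)

lemma sharpSplit_hasType_and_app (hΓ : Derivable S (.ctx Γ))
    (hB : Derivable S (.tm (Γ.promote (φ ⊓ ψ)) B (.univ i))) :
    Derivable S (.tm Γ (sharpSplit φ ψ B)
      (arrow (sharp (φ ⊓ ψ) B) (sharp φ (sharp ψ B)))) ∧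
    ∀ (Δ : Cxt F K) (N : Tm F K), Derivable S (.ctx Δ) → Γ.Sub Δ →
      Derivable S (.tm Δ N (sharp (φ ⊓ ψ) B)) →
      Derivable S (.eq Δ (app (sharpSplit φ ψ B) N)
        (sharpIntro φ (sharpIntro ψ (sharpElim (φ ⊓ ψ) N))) (sharp φ (sharp ψ B))) :=
  lam_arrow_of_open (fun _ => rfl) hΓ (.sharp_form hΓ hB) hB.lc.1 fun _ _ hΔ _ hN =>
    sharp_sharp_intro hΔ (sharpElim_promote hΔ le_rfl (to_promote hΔ hN _))

/-- After unfolding the functions, the inner introductions cancel inside the promoted context by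
`β`, and what remains is an `η`-expansion. -/
lemma sharpComm_sharpComm (hΓ : Derivable S (.ctx Γ))
    (hB : Derivable S (.tm (Γ.promote (φ ⊓ ψ)) B (.univ i))) (hs : Γ.Sub Δ)
    (hΔ : Derivable S (.ctx Δ)) (hN : Derivable S (.tm Δ N (sharp φ (sharp ψ B)))) :
    Derivable S (.eq Δ (app (sharpComm ψ φ B) (app (sharpComm φ ψ B) N)) N
      (sharp φ (sharp ψ B))) := by
  have h' := sharpComm_hasType_and_app (φ := ψ) (ψ := φ) hΓ (by rwa [inf_comm])
  have hE := sharp_sharp_elim hΔ (inf_le_left : φ ⊓ ψ ≤ φ) inf_le_right hN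
  refine .eq_trans (app_arrow_cong (B := sharp φ (sharp ψ B)) hB.lc.1 (h'.1.weaken hΔ hs)
    ((sharpComm_hasType_and_app hΓ hB).2 Δ N hΔ hs hN)) ?_
  refine .eq_trans (h'.2 Δ _ hΔ hs (sharp_sharp_intro hΔ (by rwa [inf_comm]))) ?_
  exact .eq_trans
    (sharp_sharp_intro_cong hΔ (sharp_sharp_beta hΔ inf_le_right inf_le_left hE))
    (sharp_sharp_eta hΔ hN)

lemma sharpSplit_sharpMerge (hΓ : Derivable S (.ctx Γ))
    (hB : Derivable S (.tm (Γ.promote (φ ⊓ ψ)) B (.univ i))) (hs : Γ.Sub Δ)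
    (hΔ : Derivable S (.ctx Δ)) (hN : Derivable S (.tm Δ N (sharp φ (sharp ψ B)))) :
    Derivable S (.eq Δ (app (sharpSplit φ ψ B) (app (sharpMerge φ ψ B) N)) N
      (sharp φ (sharp ψ B))) := by
  have h' := sharpSplit_hasType_and_app hΓ hB
  have hE := sharp_sharp_elim hΔ (inf_le_left : φ ⊓ ψ ≤ φ) inf_le_right hN
  refine .eq_trans (app_arrow_cong (B := sharp φ (sharp ψ B)) hB.lc.1 (h'.1.weaken hΔ hs)
    ((sharpMerge_hasType_and_app hΓ hB).2 Δ N hΔ hs hN)) ?_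
  refine .eq_trans (h'.2 Δ _ hΔ hs (.sharp_intro hΔ hE)) ?_
  exact .eq_trans
    (sharp_sharp_intro_cong hΔ (sharpElim_sharpIntro_promote hΔ le_rfl hE))
    (sharp_sharp_eta hΔ hN)

lemma sharpMerge_sharpSplit (hΓ : Derivable S (.ctx Γ))
    (hB : Derivable S (.tm (Γ.promote (φ ⊓ ψ)) B (.univ i))) (hs : Γ.Sub Δ)
    (hΔ : Derivable S (.ctx Δ)) (hN : Derivable S (.tm Δ N (sharp (φ ⊓ ψ) B))) :
    Derivable S (.eq Δ (app (sharpMerge φ ψ B) (app (sharpSplit φ ψ B) N)) N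
      (sharp (φ ⊓ ψ) B)) := by
  have h' := sharpMerge_hasType_and_app hΓ hB
  have hE := sharpElim_promote hΔ le_rfl (to_promote hΔ hN (φ ⊓ ψ))
  refine .eq_trans (app_arrow_cong (B := sharp (φ ⊓ ψ) B) hB.lc.1 (h'.1.weaken hΔ hs)
    ((sharpSplit_hasType_and_app hΓ hB).2 Δ N hΔ hs hN)) ?_
  refine .eq_trans (h'.2 Δ _ hΔ hs (sharp_sharp_intro hΔ hE)) ?_
  exact .eq_trans
    (.sharp_intro_cong hΔ (sharp_sharp_beta hΔ inf_le_left inf_le_right hE))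
    (.eq_symm (.sharp_eta hN))

lemma sharpComm_isEquiv (hΓ : Derivable S (.ctx Γ))
    (hB : Derivable S (.tm (Γ.promote (φ ⊓ ψ)) B (.univ i))) :
    S.Inhabited Γ (isEquiv (sharp φ (sharp ψ B)) (sharp ψ (sharp φ B)) (sharpComm φ ψ B)) ∧
      S.DefInverse Γ (sharp φ (sharp ψ B)) (sharp ψ (sharp φ B))
        (sharpComm φ ψ B) (sharpComm ψ φ B) := by
  have hB' : Derivable S (.tm (Γ.promote (ψ ⊓ φ)) B (.univ i)) := by rwa [inf_comm]
  refine isEquiv_and_defInverse hΓ (sharp_sharp_form hΓ hB) (sharp_sharp_form hΓ hB')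
    (sharpComm_hasType_and_app hΓ hB).1 (sharpComm_hasType_and_app hΓ hB').1
    (fun x hx => ?_) (fun x hx => ?_)
  · have hx := ctx_cons_top hΓ (sharp_sharp_form hΓ hB) hx
    exact sharpComm_sharpComm hΓ hB (Cxt.Sub.refl Γ).weak hx hx.var_head
  · have hx := ctx_cons_top hΓ (sharp_sharp_form hΓ hB') hx
    exact sharpComm_sharpComm hΓ hB' (Cxt.Sub.refl Γ).weak hx hx.var_head

lemma sharpMerge_isEquiv (hΓ : Derivable S (.ctx Γ))
    (hB : Derivable S (.tm (Γ.promote (φ ⊓ ψ)) B (.univ i))) :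
    S.Inhabited Γ (isEquiv (sharp φ (sharp ψ B)) (sharp (φ ⊓ ψ) B) (sharpMerge φ ψ B)) ∧
      S.DefInverse Γ (sharp φ (sharp ψ B)) (sharp (φ ⊓ ψ) B)
        (sharpMerge φ ψ B) (sharpSplit φ ψ B) := by
  refine isEquiv_and_defInverse hΓ (sharp_sharp_form hΓ hB) (.sharp_form hΓ hB)
    (sharpMerge_hasType_and_app hΓ hB).1 (sharpSplit_hasType_and_app hΓ hB).1
    (fun x hx => ?_) (fun x hx => ?_)
  · have hx := ctx_cons_top hΓ (sharp_sharp_form hΓ hB) hx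
    exact sharpSplit_sharpMerge hΓ hB (Cxt.Sub.refl Γ).weak hx hx.var_head
  · have hx := ctx_cons_top hΓ (.sharp_form hΓ hB) hx
    exact sharpMerge_sharpSplit hΓ hB (Cxt.Sub.refl Γ).weak hx hx.var_head

end Derivable

theorem mainTheorem10 {F : Type u} [SemilatticeInf F] [OrderTop F] {K : Type v}
    (S : Signature F K) (φ ψ : F) (Γ : Cxt F K) (hΓ : S.IsCtx Γ) :
    -- for every `φψ`-crisp type `A`, the map `♭_φ ♭_ψ A → ♭_ψ ♭_φ A` is an equivalence ...
    (∀ A : Tm F K, S.IsType (Γ.divide (φ ⊓ ψ)) A →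
      S.HasType Γ (Tm.flatComm φ ψ A)
        (Tm.arrow (Tm.flat φ (Tm.flat ψ A)) (Tm.flat ψ (Tm.flat φ A))) ∧
      S.Inhabited Γ
        (Tm.isEquiv (Tm.flat φ (Tm.flat ψ A)) (Tm.flat ψ (Tm.flat φ A)) (Tm.flatComm φ ψ A)) ∧
      -- ... natural with respect to `φψ`-crisp functions `f : A → B` of `φψ`-crisp types
      ∀ B f : Tm F K, S.IsType (Γ.divide (φ ⊓ ψ)) B →
        S.HasType (Γ.divide (φ ⊓ ψ)) f (Tm.arrow A B) →
        S.HasType Γ (Tm.flatFlatMap φ ψ A f)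
          (Tm.arrow (Tm.flat φ (Tm.flat ψ A)) (Tm.flat φ (Tm.flat ψ B))) ∧
        S.HasType Γ (Tm.flatFlatMap ψ φ A f)
          (Tm.arrow (Tm.flat ψ (Tm.flat φ A)) (Tm.flat ψ (Tm.flat φ B))) ∧
        S.Inhabited Γ
          (Tm.pi (Tm.flat φ (Tm.flat ψ A))
            (Tm.idt (Tm.flat ψ (Tm.flat φ B))
              (Tm.app (Tm.flatFlatMap ψ φ A f) (Tm.app (Tm.flatComm φ ψ A) (Tm.bvar 0)))
              (Tm.app (Tm.flatComm φ ψ B)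
                (Tm.app (Tm.flatFlatMap φ ψ A f) (Tm.bvar 0)))))) ∧
    -- for every type `B`, the maps `♯_φ ♯_ψ B → ♯_ψ ♯_φ B`, `♯_φ ♯_ψ B → ♯_{φψ} B` and
    -- `♯_ψ ♯_φ B → ♯_{φψ} B` are equivalences, with definitional inverses
    (∀ B : Tm F K, S.IsType (Γ.promote (φ ⊓ ψ)) B →
      (S.Inhabited Γ (Tm.isEquiv (Tm.sharp φ (Tm.sharp ψ B)) (Tm.sharp ψ (Tm.sharp φ B))
          (Tm.sharpComm φ ψ B)) ∧
        S.DefInverse Γ (Tm.sharp φ (Tm.sharp ψ B)) (Tm.sharp ψ (Tm.sharp φ B))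
          (Tm.sharpComm φ ψ B) (Tm.sharpComm ψ φ B)) ∧
      (S.Inhabited Γ (Tm.isEquiv (Tm.sharp φ (Tm.sharp ψ B)) (Tm.sharp (φ ⊓ ψ) B)
          (Tm.sharpMerge φ ψ B)) ∧
        S.DefInverse Γ (Tm.sharp φ (Tm.sharp ψ B)) (Tm.sharp (φ ⊓ ψ) B)
          (Tm.sharpMerge φ ψ B) (Tm.sharpSplit φ ψ B)) ∧
      (S.Inhabited Γ (Tm.isEquiv (Tm.sharp ψ (Tm.sharp φ B)) (Tm.sharp (φ ⊓ ψ) B)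
          (Tm.sharpMerge ψ φ B)) ∧
        S.DefInverse Γ (Tm.sharp ψ (Tm.sharp φ B)) (Tm.sharp (φ ⊓ ψ) B)
          (Tm.sharpMerge ψ φ B) (Tm.sharpSplit ψ φ B))) := by
  refine ⟨?_, ?_⟩
  · rintro A ⟨i, hA⟩
    have hA' : Derivable S (.tm (Γ.divide (ψ ⊓ φ)) A (.univ i)) := by rwa [inf_comm]
    refine ⟨.flatComm_hasType hΓ hA,
      Derivable.inhabited_isEquiv hΓ (.flat_flat_form hΓ hA) (.flat_flat_form hΓ hA')
        (.flatComm_hasType hΓ hA) (.flatComm_hasType hΓ hA')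
        (Derivable.flatComm_flatComm hΓ hA) (Derivable.flatComm_flatComm hΓ hA'), ?_⟩
    rintro B f ⟨j, hB⟩ hf
    refine ⟨.flatFlatMap_hasType hΓ hA hB hf, ?_, Derivable.flatComm_natural hΓ hA hB hf⟩
    rw [inf_comm] at hA hB hf
    exact .flatFlatMap_hasType hΓ hA hB hf
  · rintro B ⟨i, hB⟩
    have hB' : Derivable S (.tm (Γ.promote (ψ ⊓ φ)) B (.univ i)) := by rwa [inf_comm]
    have h := Derivable.sharpMerge_isEquiv hΓ hB'
    rw [inf_comm ψ φ] at h
    exact ⟨Derivable.sharpComm_isEquiv hΓ hB, Derivable.sharpMerge_isEquiv hΓ hB, h⟩
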